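/- A \emph{tree} on a finite set $I$ is a (non-planar) rooted binary tree whose leaves are bijectively labeled by $I$; a \emph{forest} on $I$ is a set of such trees whose label sets partition $I$. Edges are oriented towards the roots, and $V(F)$ is the set of inner vertices of $F$. For forests $F,F'$ on $I$ put $F\le F'$ if there is a topological map from $F$ to $F'$ that is increasing with respect to the orientation towards the root, maps inner vertices to inner vertices injectively, restricts to the identity of $I$ on the leaves, and is injective on each tree of $F$. This is a partial order, and the map is determined up to isotopy by $F$ and $F'$. For a finite poset $P$ with least element $\hat 0$ and greatest element $\hat 1$, let $\operatorname{rk}(a)$ be the length of a longest chain from $\hat 0$ to $a$ (the usual rank if $P$ is ranked), let $\operatorname{crk}(a)=\operatorname{rk}(\hat 1)-\operatorname{rk}(a)$, let $\mu$ be the Möbius function of $P$, and let $$M(P)=\sum_{a\le b}\mu(a,b)\,x^{\operatorname{crk}(a)}y^{\operatorname{crk}(b)}\in\mathbb Z[x,y].$$ Let $T_1,T_2$ be trees on disjoint finite sets $I_1,I_2$, and let $T=T_1\vee T_2$ be the tree on $I_1\sqcup I_2$ obtained by grafting the roots of $T_1$ and $T_2$ on a new inner vertex. Let $F\le T$ be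 a forest on $I_1\sqcup I_2$ such that the image of $V(F)$ in $V(T)$ does not contain this lowest inner vertex of $T$. Then $F=F_1\sqcup F_2$ for forests $F_1\le T_1$ on $I_1$ and $F_2\le T_2$ on $I_2$, and, with $M=M([F,T])$, $M_1=M([F_1,T_1])$ and $M_2=M([F_2,T_2])$, $$M = xy\,M_1M_2+(1-x)\,\partial_x(xM_1)\,\partial_x(xM_2).$$ In this sense $M$ depends only on $M_1$ and $M_2$. -/

import Mathlib

/-- A forest of leaf-labelled rooted binary trees on the finite label set `I`.
A vertex (inner vertex or leaf) is recorded by the set of its ancestor leaves, that is, the labels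
of the leaves from which the path to the root goes through the vertex. Hence a non-planar forest,
up to isomorphism fixing the labels, is the same as such a family of sets. -/
@[ext]
structure Forest {α : Type*} [DecidableEq α] (I : Finset α) where
  clusters : Finset (Finset α)
  subset : ∀ s ∈ clusters, s ⊆ I
  nonempty : ∀ s ∈ clusters, s.Nonempty
  leaf : ∀ i ∈ I, {i} ∈ clusters
  laminar : ∀ s ∈ clusters, ∀ t ∈ clusters, s ⊆ t ∨ t ⊆ s ∨ Disjoint s t
  binary : ∀ s ∈ clusters, 1 < s.card →
    ∃ a ∈ clusters, ∃ b ∈ clusters, Disjoint a b ∧ a ∪ b = s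

namespace Forest

variable {α : Type*} [DecidableEq α] {I : Finset α}

/-- The leaves and the inner vertices of `F`; `u ≤ v` means that `v` lies on the path from `u` to
the root. -/
abbrev Vertex (F : Forest I) : Type _ := {s : Finset α // s ∈ F.clusters}

/-- The leaf with label `i`. -/
def leafVertex (F : Forest I) (i : α) (hi : i ∈ I) : F.Vertex := ⟨{i}, F.leaf i hi⟩

/-- Inner vertices are the vertices that are not leaves. -/
def Vertex.IsInner {F : Forest I} (v : F.Vertex) : Prop := 1 < v.1.card

/-- A forest on `I` is a tree if it has a vertex below all leaves. -/
def IsTree (F : Forest I) : Prop := I ∈ F.clusters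

/-- Topological maps between forests, up to isotopy, recorded by the images of the vertices.
An edge of a forest (other than the edges that end in the roots, which impose no condition) is a
pair `c ⋖ p`; it is sent to the path from the image of `c` down to the image of `p`,
which runs through the edges that start in the elements of `Set.Ico (f c) (f p)`. -/
structure Map (F F' : Forest I) where
  toFun : F.Vertex → F'.Vertex
  /-- increasing with respect to orientation towards the root -/
  mono : Monotone toFun
  /-- inner vertices go to inner vertices -/
  inner : ∀ v : F.Vertex, v.IsInner → (toFun v).IsInner
  /-- injective on inner vertices -/
  inj : ∀ u v : F.Vertex, u.IsInner → v.IsInner → toFun u = toFun v → u = v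
  /-- identity on leaves -/
  leaf : ∀ (i : α) (hi : i ∈ I), toFun (F.leafVertex i hi) = F'.leafVertex i hi
  /-- injective on each tree of `F`: two different edges of a same tree are sent to paths without
  a common edge -/
  injOnTree : ∀ c p c' p' r : F.Vertex, c ⋖ p → c' ⋖ p' → p ≤ r → p' ≤ r → c ≠ c' →
    Disjoint (Set.Ico (toFun c) (toFun p)) (Set.Ico (toFun c') (toFun p'))

theorem Vertex.total {F : Forest I} {w u v : F.Vertex} (hu : w ≤ u) (hv : w ≤ v) :
    u ≤ v ∨ v ≤ u := by
  rcases F.laminar u.1 u.2 v.1 v.2 with h | h | h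
  · exact Or.inl h
  · exact Or.inr h
  · obtain ⟨i, hi⟩ := F.nonempty w.1 w.2
    exact absurd (hv hi) (Finset.disjoint_left.mp h (hu hi))

/-- The identity map. -/
def Map.id (F : Forest I) : Map F F where
  toFun v := v
  mono := fun _ _ h => h
  inner := fun _ h => h
  inj := fun _ _ _ _ h => h
  leaf := fun _ _ => rfl
  injOnTree := by
    intro c p c' p' r h h' _ _ hne
    rw [h.Ico_eq, h'.Ico_eq]
    exact Set.disjoint_singleton.mpr hne

theorem Map.exists_edge {F F' : Forest I} (g : Map F F') {a b : F.Vertex} (hab : a ≤ b)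
    {w : F'.Vertex} (hw : w ∈ Set.Ico (g.toFun a) (g.toFun b)) :
    ∃ e q : F.Vertex, e ⋖ q ∧ q ≤ b ∧ e ∈ Set.Ico a b ∧ w ∈ Set.Ico (g.toFun e) (g.toFun q) := by
  have hlt : a < b := by
    refine lt_of_le_of_ne hab ?_
    rintro rfl
    exact absurd (hw.1.trans_lt hw.2) (lt_irrefl _)
  obtain ⟨e, he⟩ := (Set.toFinite {e : F.Vertex | e ∈ Set.Ico a b ∧ g.toFun e ≤ w}).exists_maximal
    ⟨a, ⟨le_refl _, hlt⟩, hw.1⟩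
  obtain ⟨⟨hae, heb⟩, hew⟩ := he.prop
  obtain ⟨q, heq, hqb⟩ := exists_covBy_le_of_lt heb
  refine ⟨e, q, heq, hqb, ⟨hae, heb⟩, hew, ?_⟩
  have hn : ¬ g.toFun q ≤ w := by
    intro hqw
    rcases hqb.lt_or_eq with h | rfl
    · exact absurd (he.le_of_ge (y := q) ⟨⟨hae.trans heq.lt.le, h⟩, hqw⟩ heq.lt.le) heq.lt.not_ge
    · exact absurd hw.2 hqw.not_gt
  rcases Vertex.total hew (g.mono heq.lt.le) with h | h
  · exact lt_of_le_not_ge h hn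
  · exact absurd h hn

/-- The composition of two maps. -/
def Map.comp {F F' F'' : Forest I} (g : Map F' F'') (f : Map F F') : Map F F'' where
  toFun v := g.toFun (f.toFun v)
  mono := g.mono.comp f.mono
  inner := fun v h => g.inner _ (f.inner v h)
  inj := fun u v hu hv h => f.inj u v hu hv (g.inj _ _ (f.inner u hu) (f.inner v hv) h)
  leaf := fun i hi => by rw [f.leaf, g.leaf]
  injOnTree := by
    intro c p c' p' r h h' hr hr' hne
    rw [Set.disjoint_left]
    intro w hw hw'
    obtain ⟨e, q, heq, hq, he, hwe⟩ := g.exists_edge (f.mono h.lt.le) hw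
    obtain ⟨e', q', heq', hq', he', hwe'⟩ := g.exists_edge (f.mono h'.lt.le) hw'
    have hee : e ≠ e' := by
      rintro rfl
      exact Set.disjoint_left.mp (f.injOnTree c p c' p' r h h' hr hr' hne) he he'
    exact Set.disjoint_left.mp (g.injOnTree e q e' q' (f.toFun r) heq heq'
      (hq.trans (f.mono hr)) (hq'.trans (f.mono hr')) hee) hwe hwe'

theorem Map.subset_toFun {F F' : Forest I} (f : Map F F') (v : F.Vertex) :
    v.1 ⊆ (f.toFun v).1 := by
  intro i hi
  have h : F.leafVertex i (F.subset _ v.2 hi) ≤ v := Finset.singleton_subset_iff.mpr hi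
  have h' := f.mono h
  rw [f.leaf] at h'
  exact Finset.singleton_subset_iff.mp h'

theorem Map.injective {F F' : Forest I} (f : Map F F') : Function.Injective f.toFun := by
  have key : ∀ u : F.Vertex, ¬ u.IsInner → ∃ i, ∃ hi : i ∈ I, u = F.leafVertex i hi := by
    intro u hu
    have h1 : u.1.card = 1 :=
      le_antisymm (not_lt.mp hu) (Finset.card_pos.mpr (F.nonempty _ u.2))
    obtain ⟨i, hi⟩ := Finset.card_eq_one.mp h1
    exact ⟨i, F.subset _ u.2 (by rw [hi]; exact Finset.mem_singleton_self i), Subtype.ext hi⟩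
  have hl : ∀ (i : α) (hi : i ∈ I), ¬ (F'.leafVertex i hi).IsInner := by
    intro i hi h
    simp [Vertex.IsInner, leafVertex] at h
  intro u v huv
  by_cases hu : u.IsInner <;> by_cases hv : v.IsInner
  · exact f.inj u v hu hv huv
  · obtain ⟨i, hi, rfl⟩ := key v hv
    have := f.inner u hu
    rw [huv, f.leaf] at this
    exact absurd this (hl i hi)
  · obtain ⟨i, hi, rfl⟩ := key u hu
    have := f.inner v hv
    rw [← huv, f.leaf] at this
    exact absurd this (hl i hi)
  · obtain ⟨i, hi, rfl⟩ := key u hu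
    obtain ⟨j, hj, rfl⟩ := key v hv
    rw [f.leaf, f.leaf] at huv
    have : ({i} : Finset α) = {j} := congrArg Subtype.val huv
    obtain rfl := Finset.singleton_injective this
    rfl

theorem Map.clusters_subset {F F' : Forest I} (f : Map F F') (g : Map F' F) :
    F.clusters ⊆ F'.clusters := by
  have hinj : Function.Injective fun v => g.toFun (f.toFun v) := g.injective.comp f.injective
  have hbij : Function.Bijective fun v => g.toFun (f.toFun v) :=
    Finite.injective_iff_bijective.mp hinj
  have hle : ∀ v : F.Vertex, v.1.card ≤ (g.toFun (f.toFun v)).1.card := fun v =>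
    Finset.card_le_card ((f.subset_toFun v).trans (g.subset_toFun _))
  have hsum : ∑ v : F.Vertex, v.1.card = ∑ v : F.Vertex, (g.toFun (f.toFun v)).1.card :=
    (hbij.sum_comp fun v : F.Vertex => v.1.card).symm
  have heq := (Finset.sum_eq_sum_iff_of_le fun v _ => hle v).mp hsum
  intro s hs
  have h1 := f.subset_toFun ⟨s, hs⟩
  have h2 := g.subset_toFun (f.toFun ⟨s, hs⟩)
  have h3 : s = (g.toFun (f.toFun ⟨s, hs⟩)).1 :=
    Finset.eq_of_subset_of_card_le (h1.trans h2) (heq ⟨s, hs⟩ (Finset.mem_univ _)).ge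
  have h4 : s = (f.toFun ⟨s, hs⟩).1 := Finset.Subset.antisymm h1 (h2.trans h3.ge)
  rw [h4]
  exact (f.toFun ⟨s, hs⟩).2

/-- The poset of forests on `I`: `F ≤ F'` if there is a map from `F` to `F'`. -/
instance : PartialOrder (Forest I) where
  le F F' := Nonempty (Map F F')
  le_refl F := ⟨Map.id F⟩
  le_trans := fun _ _ _ ⟨f⟩ ⟨g⟩ => ⟨g.comp f⟩
  le_antisymm := fun _ _ ⟨f⟩ ⟨g⟩ =>
    Forest.ext (Finset.Subset.antisymm (f.clusters_subset g) (g.clusters_subset f))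

instance : Finite (Forest I) := by
  refine Finite.of_injective
    (fun F : Forest I => (⟨F.clusters, ?_⟩ : {c // c ∈ I.powerset.powerset})) ?_
  · exact Finset.mem_powerset.mpr fun s hs => Finset.mem_powerset.mpr (F.subset s hs)
  · intro F F' h
    exact Forest.ext (congrArg Subtype.val h)

/-- The disjoint union `F₁ ⊔ F₂` of forests on disjoint label sets. -/
def disjUnion {I₁ I₂ : Finset α} (F₁ : Forest I₁) (F₂ : Forest I₂) (hI : Disjoint I₁ I₂) :
    Forest (I₁ ∪ I₂) where
  clusters := F₁.clusters ∪ F₂.clusters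
  subset := by
    intro s hs
    rcases Finset.mem_union.mp hs with h | h
    · exact (F₁.subset s h).trans Finset.subset_union_left
    · exact (F₂.subset s h).trans Finset.subset_union_right
  nonempty := fun s hs => (Finset.mem_union.mp hs).elim (F₁.nonempty s) (F₂.nonempty s)
  leaf := by
    intro i hi
    rcases Finset.mem_union.mp hi with h | h
    · exact Finset.mem_union_left _ (F₁.leaf i h)
    · exact Finset.mem_union_right _ (F₂.leaf i h)
  laminar := by
    intro s hs t ht
    rcases Finset.mem_union.mp hs with h | h <;> rcases Finset.mem_union.mp ht with h' | h'
    · exact F₁.laminar s h t h'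
    · exact Or.inr (Or.inr (hI.mono (F₁.subset s h) (F₂.subset t h')))
    · exact Or.inr (Or.inr (hI.symm.mono (F₂.subset s h) (F₁.subset t h')))
    · exact F₂.laminar s h t h'
  binary := by
    intro s hs hcard
    rcases Finset.mem_union.mp hs with h | h
    · obtain ⟨a, ha, b, hb, hab⟩ := F₁.binary s h hcard
      exact ⟨a, Finset.mem_union_left _ ha, b, Finset.mem_union_left _ hb, hab⟩
    · obtain ⟨a, ha, b, hb, hab⟩ := F₂.binary s h hcard
      exact ⟨a, Finset.mem_union_right _ ha, b, Finset.mem_union_right _ hb, hab⟩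

/-- The tree `T₁ ∨ T₂` obtained by grafting the roots of `T₁` and `T₂` on a new inner vertex. This
new vertex, the lowest inner vertex of `T₁ ∨ T₂`, is recorded by `I₁ ∪ I₂`. -/
def vee {I₁ I₂ : Finset α} (T₁ : Forest I₁) (T₂ : Forest I₂) (h₁ : T₁.IsTree) (h₂ : T₂.IsTree)
    (hI : Disjoint I₁ I₂) : Forest (I₁ ∪ I₂) where
  clusters := insert (I₁ ∪ I₂) (disjUnion T₁ T₂ hI).clusters
  subset := by
    intro s hs
    rcases Finset.mem_insert.mp hs with rfl | h
    · exact Finset.Subset.refl _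
    · exact (disjUnion T₁ T₂ hI).subset s h
  nonempty := by
    intro s hs
    rcases Finset.mem_insert.mp hs with rfl | h
    · exact (T₁.nonempty _ h₁).mono Finset.subset_union_left
    · exact (disjUnion T₁ T₂ hI).nonempty s h
  leaf := fun i hi => Finset.mem_insert_of_mem ((disjUnion T₁ T₂ hI).leaf i hi)
  laminar := by
    intro s hs t ht
    rcases Finset.mem_insert.mp hs with rfl | h <;> rcases Finset.mem_insert.mp ht with rfl | h'
    · exact Or.inl (Finset.Subset.refl _)
    · exact Or.inr (Or.inl ((disjUnion T₁ T₂ hI).subset t h'))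
    · exact Or.inl ((disjUnion T₁ T₂ hI).subset s h)
    · exact (disjUnion T₁ T₂ hI).laminar s h t h'
  binary := by
    intro s hs hcard
    rcases Finset.mem_insert.mp hs with rfl | h
    · exact ⟨I₁, Finset.mem_insert_of_mem (Finset.mem_union_left _ h₁),
        I₂, Finset.mem_insert_of_mem (Finset.mem_union_right _ h₂), hI, rfl⟩
    · obtain ⟨a, ha, b, hb, hab⟩ := (disjUnion T₁ T₂ hI).binary s h hcard
      exact ⟨a, Finset.mem_insert_of_mem ha, b, Finset.mem_insert_of_mem hb, hab⟩

end Forest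

/-- The corank of an element of a finite poset with a least and a greatest element: the rank of the
greatest element minus the rank of `a`, where the rank of an element is the length of a longest
chain from the least element to it (in a ranked poset, of any maximal one). -/
noncomputable def corank {P : Type*} [PartialOrder P] [BoundedOrder P] (a : P) : ℕ :=
  (Order.height (⊤ : P)).toNat - (Order.height a).toNat

open Classical in
/-- The `M`-polynomial `∑_{a ≤ b} μ(a, b) x ^ crk a y ^ crk b` of a finite poset, in the variables
`x = X 0` and `y = X 1`. -/
noncomputable def mPolynomial (P : Type*) [PartialOrder P] [BoundedOrder P] [Finite P] :
    MvPolynomial (Fin 2) ℤ :=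
  letI : Fintype P := Fintype.ofFinite P
  letI : LocallyFiniteOrder P := Fintype.toLocallyFiniteOrder
  ∑ a : P, ∑ b ∈ Finset.univ.filter (fun b : P => a ≤ b),
    MvPolynomial.C (IncidenceAlgebra.mu ℤ a b) *
      MvPolynomial.X 0 ^ corank a * MvPolynomial.X 1 ^ corank b

/-- The `M`-polynomial of the interval `[F, F']` in the poset of forests on `I`. -/
noncomputable def Forest.intervalM {α : Type*} [DecidableEq α] {I : Finset α} {F F' : Forest I}
    (h : F ≤ F') : MvPolynomial (Fin 2) ℤ :=
  haveI : Fact (F ≤ F') := ⟨h⟩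
  mPolynomial (Set.Icc F F')

/-! A map of forests leaves no choice: a vertex `s` must go to its hull, the least cluster of the
target that contains `s`, because a target cluster that contains `s` and lies strictly inside its
image would lie on the paths of both edges into `s`. So the order is a condition on families of sets
(`Forest.le_iff`), and a forest `F` below a tree `T` is recovered from the partition of the labels
into its trees: its clusters are the nonempty traces of the clusters of `T` on the blocks
(`Forest.restrict_roots`). The partitions that occur are the admissible ones, where no vertex of `T`
is split by two blocks. Hence `[F, T]` is the poset of admissible partitions coarser than that of
`F` (`Forest.iccEquiv`). Any strict refinement of admissible partitions can be approached by merging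
two blocks at a time, so the corank is the number of trees minus one (`Forest.corank_add_one`).

For `T₁ ∨ T₂`, at most one block is split at the lowest vertex. An admissible partition is thus a
union `P₁ ⊔ P₂` of admissible partitions, or such a union with one block of `P₁` merged with one
block of `P₂`. The Möbius function of this poset is explicit (`isMoebius_graftMoebius`). For pairs
`p ≤ q`, let `μ` be the product Möbius function, `crk` the sum of the two coranks, and `n` the
number of pairs of blocks at `p`. Up to the monomial `x ^ crk p * y ^ crk q`, the ungrafted elements
contribute `x y μ`, the grafted ones `n μ`, and the mixed ones `- x n μ`. Since `n` is the product
of the two coranks at `p`, each increased by one, the factor `n` is exactly what the two operators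
`∂ₓ(x ·)` produce. -/

/-! ### Hulls, and the order of forests in terms of clusters -/

namespace Forest

variable {α : Type*}

/-- `w` is the least element of the family `C` that contains `s`. -/
def IsHull (C : Finset (Finset α)) (s w : Finset α) : Prop :=
  w ∈ C ∧ s ⊆ w ∧ ∀ w' ∈ C, s ⊆ w' → w ⊆ w'

theorem IsHull.unique {C : Finset (Finset α)} {s w w' : Finset α} (h : IsHull C s w)
    (h' : IsHull C s w') : w = w' :=
  Finset.Subset.antisymm (h.2.2 w' h'.1 h'.2.1) (h'.2.2 w h.1 h.2.1)

theorem isHull_self {C : Finset (Finset α)} {s : Finset α} (h : s ∈ C) : IsHull C s s :=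
  ⟨h, Finset.Subset.refl s, fun _ _ h => h⟩

variable [DecidableEq α] {I : Finset α}

theorem comparable (F : Forest I) {s t : Finset α} (hs : s ∈ F.clusters) (ht : t ∈ F.clusters)
    {i : α} (his : i ∈ s) (hit : i ∈ t) : s ⊆ t ∨ t ⊆ s := by
  rcases F.laminar s hs t ht with h | h | h
  · exact Or.inl h
  · exact Or.inr h
  · exact absurd hit (Finset.disjoint_left.mp h his)

theorem exists_isHull (F : Forest I) {s u : Finset α} (hs : s.Nonempty) (hu : u ∈ F.clusters)
    (hsu : s ⊆ u) : ∃ w, IsHull F.clusters s w := by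
  obtain ⟨w, hw, hmin⟩ := Finset.exists_min_image (F.clusters.filter (s ⊆ ·)) Finset.card
    ⟨u, Finset.mem_filter.mpr ⟨hu, hsu⟩⟩
  rw [Finset.mem_filter] at hw
  refine ⟨w, hw.1, hw.2, fun w' hw' hsw' => ?_⟩
  obtain ⟨i, hi⟩ := hs
  rcases F.comparable hw.1 hw' (hw.2 hi) (hsw' hi) with h | h
  · exact h
  · exact (Finset.eq_of_subset_of_card_le h
      (hmin w' (Finset.mem_filter.mpr ⟨hw', hsw'⟩))).ge

theorem covBy_of_union_eq (F : Forest I) {a b s : Finset α} (ha : a ∈ F.clusters)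
    (hb : b ∈ F.clusters) (hs : s ∈ F.clusters) (hab : Disjoint a b) (hu : a ∪ b = s) :
    (⟨a, ha⟩ : F.Vertex) ⋖ ⟨s, hs⟩ := by
  subst hu
  have hbn := F.nonempty b hb
  refine ⟨lt_of_le_of_ne Finset.subset_union_left ?_, ?_⟩
  · intro h
    have h : a = a ∪ b := congrArg Subtype.val h
    obtain ⟨i, hi⟩ := hbn
    exact Finset.disjoint_left.mp hab (h ▸ Finset.mem_union_right a hi) hi
  · rintro ⟨x, hx⟩ h1 h2
    have h1 : a ⊂ x := h1
    have h2 : x ⊂ a ∪ b := h2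
    rcases F.laminar x hx b hb with h | h | h
    · obtain ⟨i, hi⟩ := F.nonempty a ha
      exact Finset.disjoint_left.mp hab hi (h (h1.1 hi))
    · exact h2.2 (Finset.union_subset h1.1 h)
    · refine h1.2 fun i hi => ?_
      exact (Finset.mem_union.mp (h2.1 hi)).resolve_right (Finset.disjoint_left.mp h hi)

theorem card_lt_of_union_eq (F : Forest I) {a b s : Finset α} (hb : b ∈ F.clusters)
    (hab : Disjoint a b) (hu : a ∪ b = s) : a.card < s.card := by
  rw [← hu, Finset.card_union_of_disjoint hab]
  have := Finset.card_pos.mpr (F.nonempty b hb)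
  omega

/-- Both edges into `s` are sent to paths that end in the image of `s`. If the images of the
children were comparable, the larger one would lie on both paths. -/
theorem Map.disjoint_children {F G : Forest I} (f : Map F G) {a b s : Finset α}
    (ha : a ∈ F.clusters) (hb : b ∈ F.clusters) (hs : s ∈ F.clusters) (hab : Disjoint a b)
    (hu : a ∪ b = s) : Disjoint (f.toFun ⟨a, ha⟩).1 (f.toFun ⟨b, hb⟩).1 := by
  have ca := F.covBy_of_union_eq ha hb hs hab hu
  have cb := F.covBy_of_union_eq hb ha hs hab.symm ((Finset.union_comm b a).trans hu)
  have hne : (⟨a, ha⟩ : F.Vertex) ≠ ⟨b, hb⟩ := by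
    intro h
    have h : a = b := congrArg Subtype.val h
    subst h
    exact (F.nonempty a ha).ne_empty (disjoint_self.mp hab)
  have hd := f.injOnTree _ _ _ _ _ ca cb (le_refl _) (le_refl _) hne
  have hst := f.mono.strictMono_of_injective f.injective
  rcases G.laminar _ (f.toFun ⟨a, ha⟩).2 _ (f.toFun ⟨b, hb⟩).2 with h | h | h
  · exact (Set.disjoint_left.mp hd (show f.toFun ⟨b, hb⟩ ∈ _ from ⟨h, hst cb.lt⟩)
      ⟨le_refl _, hst cb.lt⟩).elim
  · exact (Set.disjoint_left.mp hd (show f.toFun ⟨a, ha⟩ ∈ _ from ⟨le_refl _, hst ca.lt⟩)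
      ⟨h, hst ca.lt⟩).elim
  · exact h

theorem not_inner_eq (F : Forest I) {s : Finset α} (hs : s ∈ F.clusters) (h : ¬ 1 < s.card) :
    ∃ i ∈ I, s = {i} := by
  have h1 : s.card = 1 := le_antisymm (not_lt.mp h) (Finset.card_pos.mpr (F.nonempty _ hs))
  obtain ⟨i, hi⟩ := Finset.card_eq_one.mp h1
  exact ⟨i, F.subset _ hs (by rw [hi]; exact Finset.mem_singleton_self i), hi⟩

/-- This makes the map unique. A cluster that contains `s` meets the disjoint images of both
children, hence contains both; were it strictly inside the image of `s`, it would lie on the paths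
of both edges. -/
theorem Map.isHull {F G : Forest I} (f : Map F G) {s : Finset α} (hs : s ∈ F.clusters) :
    IsHull G.clusters s (f.toFun ⟨s, hs⟩).1 := by
  refine ⟨(f.toFun ⟨s, hs⟩).2, f.subset_toFun ⟨s, hs⟩, fun w hw hsw => ?_⟩
  by_cases hc : 1 < s.card
  · obtain ⟨a, ha, b, hb, hab, hu⟩ := F.binary s hs hc
    have hd := f.disjoint_children ha hb hs hab hu
    have ca := F.covBy_of_union_eq ha hb hs hab hu
    have cb := F.covBy_of_union_eq hb ha hs hab.symm ((Finset.union_comm b a).trans hu)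
    have hsa := f.subset_toFun ⟨a, ha⟩
    have hsb := f.subset_toFun ⟨b, hb⟩
    obtain ⟨i, hi⟩ := F.nonempty a ha
    obtain ⟨j, hj⟩ := F.nonempty b hb
    have his : i ∈ s := hu ▸ Finset.mem_union_left b hi
    have hjs : j ∈ s := hu ▸ Finset.mem_union_right a hj
    have h1 : (f.toFun ⟨a, ha⟩).1 ⊆ w := by
      rcases G.comparable hw (f.toFun ⟨a, ha⟩).2 (hsw his) (hsa hi) with h | h
      · exact absurd (hsb hj) (Finset.disjoint_left.mp hd (h (hsw hjs)))
      · exact h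
    have h2 : (f.toFun ⟨b, hb⟩).1 ⊆ w := by
      rcases G.comparable hw (f.toFun ⟨b, hb⟩).2 (hsw hjs) (hsb hj) with h | h
      · exact absurd (h (hsw his)) (Finset.disjoint_left.mp hd (hsa hi))
      · exact h
    rcases G.comparable hw (f.toFun ⟨s, hs⟩).2 (hsw his) (f.subset_toFun ⟨s, hs⟩ his) with h | h
    · by_contra hn
      have hlt : (⟨w, hw⟩ : G.Vertex) < f.toFun ⟨s, hs⟩ := lt_of_le_not_ge h hn
      have hne : (⟨a, ha⟩ : F.Vertex) ≠ ⟨b, hb⟩ := by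
        intro h
        have h : a = b := congrArg Subtype.val h
        exact Finset.disjoint_left.mp hab hi (h ▸ hi)
      have hd := f.injOnTree _ _ _ _ _ ca cb (le_refl _) (le_refl _) hne
      exact Set.disjoint_left.mp hd (show ⟨w, hw⟩ ∈ _ from ⟨h1, hlt⟩) ⟨h2, hlt⟩
    · exact h
  · obtain ⟨i, hi, rfl⟩ := F.not_inner_eq hs hc
    have := congrArg Subtype.val (f.leaf i hi)
    exact (this : (f.toFun ⟨{i}, hs⟩).1 = {i}) ▸ hsw

/-- Descend from `r`: if `w` meets both children, it contains their disjoint images and hence `r`;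
if it meets only one, the trace on `r` is the trace on that child. -/
theorem Map.inter_mem {F G : Forest I} (f : Map F G) {w : Finset α} (hw : w ∈ G.clusters) :
    ∀ (n : ℕ) (r : Finset α), r.card = n → r ∈ F.clusters → (r ∩ w).Nonempty →
      r ∩ w ∈ F.clusters := by
  intro n
  induction n using Nat.strong_induction_on with
  | _ n ih =>
    intro r hn hr hrw
    by_cases hc : 1 < r.card
    · obtain ⟨a, ha, b, hb, hab, hu⟩ := F.binary r hr hc
      have hd := f.disjoint_children ha hb hr hab hu
      have hsa := f.subset_toFun ⟨a, ha⟩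
      have hsb := f.subset_toFun ⟨b, hb⟩
      have hca := F.card_lt_of_union_eq hb hab hu
      have hcb := F.card_lt_of_union_eq ha hab.symm ((Finset.union_comm b a).trans hu)
      by_cases h1 : (a ∩ w).Nonempty
      · by_cases h2 : (b ∩ w).Nonempty
        · obtain ⟨i, hi⟩ := h1
          obtain ⟨j, hj⟩ := h2
          rw [Finset.mem_inter] at hi hj
          have h1 : (f.toFun ⟨a, ha⟩).1 ⊆ w := by
            rcases G.comparable hw (f.toFun ⟨a, ha⟩).2 hi.2 (hsa hi.1) with h | h
            · exact absurd (hsb hj.1) (Finset.disjoint_left.mp hd (h hj.2))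
            · exact h
          have h2 : (f.toFun ⟨b, hb⟩).1 ⊆ w := by
            rcases G.comparable hw (f.toFun ⟨b, hb⟩).2 hj.2 (hsb hj.1) with h | h
            · exact absurd (h hi.2) (Finset.disjoint_left.mp hd (hsa hi.1))
            · exact h
          rw [Finset.inter_eq_left.mpr (hu ▸ Finset.union_subset (hsa.trans h1) (hsb.trans h2))]
          exact hr
        · have : r ∩ w = a ∩ w := by
            rw [← hu, Finset.union_inter_distrib_right, Finset.not_nonempty_iff_eq_empty.mp h2,
              Finset.union_empty]
          rw [this]
          exact ih _ (hn ▸ hca) a rfl ha h1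
      · have : r ∩ w = b ∩ w := by
          rw [← hu, Finset.union_inter_distrib_right, Finset.not_nonempty_iff_eq_empty.mp h1,
            Finset.empty_union]
        rw [this] at hrw ⊢
        exact ih _ (hn ▸ hcb) b rfl hb hrw
    · obtain ⟨i, hi, rfl⟩ := F.not_inner_eq hr hc
      obtain ⟨j, hj⟩ := hrw
      rw [Finset.mem_inter, Finset.mem_singleton] at hj
      rw [Finset.inter_eq_left.mpr (Finset.singleton_subset_iff.mpr (hj.1 ▸ hj.2))]
      exact hr

/-- The order of forests in terms of clusters. -/
theorem le_iff {F G : Forest I} : F ≤ G ↔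
    (∀ s ∈ F.clusters, ∃ w ∈ G.clusters, s ⊆ w) ∧
    (∀ r ∈ F.clusters, ∀ w ∈ G.clusters, (r ∩ w).Nonempty → r ∩ w ∈ F.clusters) ∧
    (∀ s ∈ F.clusters, ∀ t ∈ F.clusters, ∀ w, 1 < s.card → 1 < t.card →
      IsHull G.clusters s w → IsHull G.clusters t w → s = t) := by
  constructor
  · rintro ⟨f⟩
    refine ⟨fun s hs => ⟨_, (f.toFun ⟨s, hs⟩).2, f.subset_toFun ⟨s, hs⟩⟩,
      fun r hr w hw h => f.inter_mem hw _ r rfl hr h, fun s hs t ht w hcs hct hsw htw => ?_⟩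
    exact congrArg Subtype.val (f.inj ⟨s, hs⟩ ⟨t, ht⟩ hcs hct
      (Subtype.ext (((f.isHull hs).unique hsw).trans (htw.unique (f.isHull ht)))))
  -- Conversely, sending each cluster to its hull is a map.
  · rintro ⟨h1, h2, h3⟩
    have hex : ∀ s : F.Vertex, ∃ w : G.Vertex, IsHull G.clusters s.1 w.1 := fun s => by
      obtain ⟨u, hu, hsu⟩ := h1 s.1 s.2
      obtain ⟨w, hw⟩ := G.exists_isHull (F.nonempty _ s.2) hu hsu
      exact ⟨⟨w, hw.1⟩, hw⟩
    choose g hg using hex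
    have hmono : Monotone g := fun s t hst =>
      (hg s).2.2 _ (g t).2 (Finset.Subset.trans hst (hg t).2.1)
    refine ⟨⟨g, hmono, fun v hv => lt_of_lt_of_le hv (Finset.card_le_card (hg v).2.1), ?_, ?_, ?_⟩⟩
    · intro u v hu hv huv
      exact Subtype.ext (h3 u.1 u.2 v.1 v.2 _ hu hv (hg u) (huv ▸ hg v))
    · intro i hi
      exact Subtype.ext ((hg (F.leafVertex i hi)).unique (isHull_self (G.leaf i hi)))
    · intro c p c' p' r hc hc' hr hr' hne
      rw [Set.disjoint_left]
      rintro w ⟨hw1, hw2⟩ ⟨hw1', hw2'⟩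
      have hcw : c.1 ⊆ w.1 := (hg c).2.1.trans hw1
      have hcw' : c'.1 ⊆ w.1 := (hg c').2.1.trans hw1'
      have hcr : c.1 ⊆ r.1 := hc.lt.le.trans hr
      have hcr' : c'.1 ⊆ r.1 := hc'.lt.le.trans hr'
      obtain ⟨i, hi⟩ := F.nonempty _ c.2
      obtain ⟨i', hi'⟩ := F.nonempty _ c'.2
      -- If `w` lies on the paths of two edges of the tree above `r`, its trace on `r` is a vertex
      -- that is forced to be the upper end of either edge.
      let q : F.Vertex := ⟨r.1 ∩ w.1, h2 r.1 r.2 w.1 w.2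
        ⟨i, Finset.mem_inter.mpr ⟨hcr hi, hcw hi⟩⟩⟩
      have hcq : c ≤ q := Finset.subset_inter hcr hcw
      have hcq' : c' ≤ q := Finset.subset_inter hcr' hcw'
      have hqw : q.1 ⊆ w.1 := Finset.inter_subset_right
      -- If `q` reached `p`, then `w` would contain `p` and hence its hull `g p`; so `q` stops at
      -- `c`.
      have key : ∀ {c p : F.Vertex}, c ⋖ p → w < g p → c ≤ q → q = c := by
        intro c p hc hw2 hcq
        rcases Vertex.total hcq hc.lt.le with h | h
        · rcases hc.eq_or_eq hcq h with h | h
          · exact h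
          · exact absurd ((hg p).2.2 _ w.2 (h ▸ hqw)) hw2.not_ge
        · exact absurd ((hg p).2.2 _ w.2 (Finset.Subset.trans h hqw)) hw2.not_ge
      exact hne ((key hc hw2 hcq).symm.trans (key hc' hw2' hcq'))

end Forest

/-! ### Forests below a tree as admissible partitions of the labels -/

namespace Forest

variable {α : Type*} [DecidableEq α] {I : Finset α}

/-- The partition of the labels into the trees of a forest. -/
def roots (F : Forest I) : Finpartition I :=
  Finpartition.ofExistsUnique (F.clusters.filter fun s => ∀ t ∈ F.clusters, s ⊆ t → t = s)
    (fun s hs => F.subset s (Finset.mem_filter.mp hs).1)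
    (by
      intro i hi
      obtain ⟨s, hs, hmax⟩ := Finset.exists_max_image (F.clusters.filter (i ∈ ·)) Finset.card
        ⟨{i}, Finset.mem_filter.mpr ⟨F.leaf i hi, Finset.mem_singleton_self i⟩⟩
      rw [Finset.mem_filter] at hs
      refine ⟨s, ⟨Finset.mem_filter.mpr ⟨hs.1, fun t ht hst => ?_⟩, hs.2⟩, ?_⟩
      · exact (Finset.eq_of_subset_of_card_le hst
          (hmax t (Finset.mem_filter.mpr ⟨ht, hst hs.2⟩))).symm
      · rintro t ⟨ht, hit⟩
        rw [Finset.mem_filter] at ht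
        rcases F.comparable hs.1 ht.1 hs.2 hit with h | h
        · exact (Finset.eq_of_subset_of_card_le h
            (hmax t (Finset.mem_filter.mpr ⟨ht.1, hit⟩))).symm
        · exact (ht.2 s hs.1 h).symm)
    (fun h => Finset.not_nonempty_empty (F.nonempty _ (Finset.mem_filter.mp h).1))

theorem mem_roots {F : Forest I} {s : Finset α} :
    s ∈ F.roots.parts ↔ s ∈ F.clusters ∧ ∀ t ∈ F.clusters, s ⊆ t → t = s :=
  Finset.mem_filter

theorem exists_root {F : Forest I} {s : Finset α} (hs : s ∈ F.clusters) :
    ∃ r ∈ F.roots.parts, s ⊆ r := by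
  obtain ⟨i, hi⟩ := F.nonempty s hs
  obtain ⟨r, hr, hir⟩ := F.roots.exists_mem (F.subset s hs hi)
  refine ⟨r, hr, ?_⟩
  rw [mem_roots] at hr
  rcases F.comparable hs hr.1 hi hir with h | h
  · exact h
  · exact (hr.2 s hs h).le

theorem roots_mono {F G : Forest I} (h : F ≤ G) : F.roots ≤ G.roots := by
  intro s hs
  obtain ⟨w, hw, hsw⟩ := (le_iff.mp h).1 s (mem_roots.mp hs).1
  obtain ⟨r, hr, hwr⟩ := exists_root hw
  exact ⟨r, hr, Finset.Subset.trans hsw hwr⟩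

/-- A partition of the labels of `T` is admissible if at each inner vertex of `T` at most one of
its blocks is split. -/
def Admissible (T : Forest I) (P : Finpartition I) : Prop :=
  ∀ a ∈ T.clusters, ∀ b ∈ T.clusters, Disjoint a b → a ∪ b ∈ T.clusters →
    ∀ B ∈ P.parts, ∀ B' ∈ P.parts, (B ∩ a).Nonempty → (B ∩ b).Nonempty →
      (B' ∩ a).Nonempty → (B' ∩ b).Nonempty → B = B'

/-- A cluster that meets two disjoint clusters is comparable with each, and it cannot lie inside
either of them; so it contains both. -/
theorem isHull_split {T : Forest I} {a b r : Finset α} (ha : a ∈ T.clusters)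
    (hb : b ∈ T.clusters) (hab : Disjoint a b) (hu : a ∪ b ∈ T.clusters)
    (hra : (r ∩ a).Nonempty) (hrb : (r ∩ b).Nonempty) :
    IsHull T.clusters (r ∩ (a ∪ b)) (a ∪ b) := by
  refine ⟨hu, Finset.inter_subset_right, fun w hw hsw => ?_⟩
  obtain ⟨i, hi⟩ := hra
  obtain ⟨j, hj⟩ := hrb
  rw [Finset.mem_inter] at hi hj
  have hiw : i ∈ w := hsw (Finset.mem_inter.mpr ⟨hi.1, Finset.mem_union_left _ hi.2⟩)
  have hjw : j ∈ w := hsw (Finset.mem_inter.mpr ⟨hj.1, Finset.mem_union_right _ hj.2⟩)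
  refine Finset.union_subset ?_ ?_
  · rcases T.comparable ha hw hi.2 hiw with h | h
    · exact h
    · exact absurd hj.2 (Finset.disjoint_left.mp hab (h hjw))
  · rcases T.comparable hb hw hj.2 hjw with h | h
    · exact h
    · exact absurd (h hiw) (Finset.disjoint_left.mp hab hi.2)

theorem one_lt_card_split {a b r : Finset α} (hab : Disjoint a b)
    (hra : (r ∩ a).Nonempty) (hrb : (r ∩ b).Nonempty) : 1 < (r ∩ (a ∪ b)).card := by
  obtain ⟨i, hi⟩ := hra
  obtain ⟨j, hj⟩ := hrb
  rw [Finset.mem_inter] at hi hj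
  refine Finset.one_lt_card.mpr ⟨i, ?_, j, ?_, ?_⟩
  · exact Finset.mem_inter.mpr ⟨hi.1, Finset.mem_union_left _ hi.2⟩
  · exact Finset.mem_inter.mpr ⟨hj.1, Finset.mem_union_right _ hj.2⟩
  · rintro rfl
    exact Finset.disjoint_left.mp hab hi.2 hj.2

/-- The traces on `a ∪ b` of two blocks that split it are inner vertices of `F` with the same hull
`a ∪ b`. Injectivity on inner vertices identifies them, and two blocks with a common label are
equal. -/
theorem admissible_roots {F T : Forest I} (h : F ≤ T) : T.Admissible F.roots := by
  obtain ⟨-, h2, h3⟩ := le_iff.mp h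
  intro a ha b hb hab hu B hB B' hB' hBa hBb hBa' hBb'
  have hc := one_lt_card_split hab hBa hBb
  have hc' := one_lt_card_split hab hBa' hBb'
  have hn : (B ∩ (a ∪ b)).Nonempty := Finset.card_pos.mp (by omega)
  have hn' : (B' ∩ (a ∪ b)).Nonempty := Finset.card_pos.mp (by omega)
  have := h3 _ (h2 B (mem_roots.mp hB).1 _ hu hn) _ (h2 B' (mem_roots.mp hB').1 _ hu hn') _ hc hc'
    (isHull_split ha hb hab hu hBa hBb) (isHull_split ha hb hab hu hBa' hBb')
  obtain ⟨i, hi⟩ := hn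
  exact F.roots.eq_of_mem_parts hB hB' (Finset.mem_inter.mp hi).1
    (Finset.mem_inter.mp (this ▸ hi)).1

/-- The smallest cluster of `T` with a given trace on `B` is split by `B` if the trace is not a
leaf. -/
theorem exists_split (T : Forest I) {B c : Finset α} (hc : c ∈ T.clusters)
    (hB : 1 < (B ∩ c).card) : ∃ a ∈ T.clusters, ∃ b ∈ T.clusters, Disjoint a b ∧
      a ∪ b ∈ T.clusters ∧ (B ∩ a).Nonempty ∧ (B ∩ b).Nonempty ∧ B ∩ (a ∪ b) = B ∩ c ∧
      a ∪ b ⊆ c := by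
  obtain ⟨w, hw⟩ := T.exists_isHull (Finset.card_pos.mp (by omega)) hc
    (Finset.inter_subset_right : B ∩ c ⊆ c)
  have hwc := hw.2.2 c hc Finset.inter_subset_right
  have hBw : B ∩ w = B ∩ c := Finset.Subset.antisymm
    (Finset.inter_subset_inter_left hwc) (Finset.subset_inter Finset.inter_subset_left hw.2.1)
  obtain ⟨a, ha, b, hb, hab, rfl⟩ :=
    T.binary w hw.1 (lt_of_lt_of_le hB (Finset.card_le_card hw.2.1))
  -- A trace that misses one child lies in the other, against the minimality of the hull.
  have hlt : ∀ {a b : Finset α}, b ∈ T.clusters → Disjoint a b → a ∈ T.clusters →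
      B ∩ c ⊆ a ∪ b → (∀ w' ∈ T.clusters, B ∩ c ⊆ w' → a ∪ b ⊆ w') → (B ∩ b).Nonempty := by
    intro a b hb hab ha h1 h2
    by_contra hn
    have h3 : B ∩ c ⊆ a := by
      intro i hi
      refine (Finset.mem_union.mp (h1 hi)).resolve_right fun hib => hn ⟨i, ?_⟩
      exact Finset.mem_inter.mpr ⟨(Finset.mem_inter.mp hi).1, hib⟩
    obtain ⟨j, hj⟩ := T.nonempty b hb
    exact Finset.disjoint_left.mp hab (h2 a ha h3 (Finset.mem_union_right a hj)) hj
  refine ⟨a, ha, b, hb, hab, hw.1, ?_, ?_, hBw, hwc⟩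
  · refine hlt (a := b) ha hab.symm hb ?_ ?_
    · rw [Finset.union_comm]; exact hw.2.1
    · rw [Finset.union_comm]; exact hw.2.2
  · exact hlt hb hab ha hw.2.1 hw.2.2

/-- The forest of the restrictions of `T` to the blocks of `P`. -/
def restrict (T : Forest I) (P : Finpartition I) : Forest I where
  clusters := ((P.parts ×ˢ T.clusters).image fun x => x.1 ∩ x.2).filter Finset.Nonempty
  subset := by
    intro s hs
    simp only [Finset.mem_filter, Finset.mem_image, Finset.mem_product, Prod.exists] at hs
    obtain ⟨⟨B, c, ⟨hB, hc⟩, rfl⟩, -⟩ := hs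
    exact Finset.inter_subset_left.trans (P.subset hB)
  nonempty := fun s hs => (Finset.mem_filter.mp hs).2
  leaf := by
    intro i hi
    obtain ⟨B, hB, hiB⟩ := P.exists_mem hi
    refine Finset.mem_filter.mpr ⟨Finset.mem_image.mpr ⟨(B, {i}),
      Finset.mem_product.mpr ⟨hB, T.leaf i hi⟩, ?_⟩, Finset.singleton_nonempty i⟩
    exact Finset.inter_eq_right.mpr (Finset.singleton_subset_iff.mpr hiB)
  laminar := by
    intro s hs t ht
    simp only [Finset.mem_filter, Finset.mem_image, Finset.mem_product, Prod.exists] at hs ht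
    obtain ⟨⟨B, c, ⟨hB, hc⟩, rfl⟩, -⟩ := hs
    obtain ⟨⟨D, d, ⟨hD, hd⟩, rfl⟩, -⟩ := ht
    by_cases h : B = D
    · subst h
      rcases T.laminar c hc d hd with h | h | h
      · exact Or.inl (Finset.inter_subset_inter_left h)
      · exact Or.inr (Or.inl (Finset.inter_subset_inter_left h))
      · exact Or.inr (Or.inr (h.mono Finset.inter_subset_right Finset.inter_subset_right))
    · exact Or.inr (Or.inr ((P.disjoint hB hD h).mono Finset.inter_subset_left
        Finset.inter_subset_left))
  binary := by
    intro s hs hcard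
    simp only [Finset.mem_filter, Finset.mem_image, Finset.mem_product, Prod.exists] at hs
    obtain ⟨⟨B, c, ⟨hB, hc⟩, rfl⟩, -⟩ := hs
    obtain ⟨a, ha, b, hb, hab, -, hBa, hBb, h, -⟩ := T.exists_split hc hcard
    refine ⟨B ∩ a, Finset.mem_filter.mpr ⟨Finset.mem_image.mpr ⟨(B, a),
      Finset.mem_product.mpr ⟨hB, ha⟩, rfl⟩, hBa⟩, B ∩ b, Finset.mem_filter.mpr
      ⟨Finset.mem_image.mpr ⟨(B, b), Finset.mem_product.mpr ⟨hB, hb⟩, rfl⟩, hBb⟩,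
      hab.mono Finset.inter_subset_right Finset.inter_subset_right, ?_⟩
    rw [← h, Finset.inter_union_distrib_left]

theorem mem_restrict {T : Forest I} {P : Finpartition I} {s : Finset α} :
    s ∈ (T.restrict P).clusters ↔
      (∃ B ∈ P.parts, ∃ c ∈ T.clusters, B ∩ c = s) ∧ s.Nonempty := by
  simp only [restrict, Finset.mem_filter, Finset.mem_image, Finset.mem_product, Prod.exists,
    and_assoc, exists_and_left]

theorem part_mem_restrict {T : Forest I} (hT : T.IsTree) {P : Finpartition I} {B : Finset α}
    (hB : B ∈ P.parts) : B ∈ (T.restrict P).clusters :=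
  mem_restrict.mpr ⟨⟨B, hB, I, hT, Finset.inter_eq_left.mpr (P.subset hB)⟩,
    P.nonempty_of_mem_parts hB⟩

theorem roots_restrict {T : Forest I} (hT : T.IsTree) (P : Finpartition I) :
    (T.restrict P).roots = P := by
  ext B
  constructor
  · intro h
    rw [mem_roots, mem_restrict] at h
    obtain ⟨⟨⟨B, hB, c, hc, rfl⟩, hn⟩, h⟩ := h
    rwa [← h B (part_mem_restrict hT hB) Finset.inter_subset_left]
  · intro hB
    refine mem_roots.mpr ⟨part_mem_restrict hT hB, fun t ht hBt => ?_⟩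
    obtain ⟨⟨D, hD, c, hc, rfl⟩, hn⟩ := mem_restrict.mp ht
    obtain ⟨i, hi⟩ := P.nonempty_of_mem_parts hB
    have := P.eq_of_mem_parts hB hD hi (Finset.mem_inter.mp (hBt hi)).1
    subst this
    exact Finset.Subset.antisymm Finset.inter_subset_left hBt

/-- Let `s` be an inner vertex in the tree with root `r`, with hull `w` in `T`. Then `r ∩ w` is also
a vertex of `F` with hull `w`, so injectivity forces `s = r ∩ w`. -/
theorem restrict_roots {F T : Forest I} (h : F ≤ T) : T.restrict F.roots = F := by
  obtain ⟨h1, h2, h3⟩ := le_iff.mp h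
  ext s
  constructor
  · intro hs
    obtain ⟨⟨B, hB, c, hc, rfl⟩, hn⟩ := mem_restrict.mp hs
    exact h2 B (mem_roots.mp hB).1 c hc hn
  · intro hs
    obtain ⟨r, hr, hsr⟩ := exists_root hs
    have hn := F.nonempty s hs
    obtain ⟨u, hu, hsu⟩ := h1 s hs
    obtain ⟨w, hw⟩ := T.exists_isHull hn hu hsu
    have hsrw : s ⊆ r ∩ w := Finset.subset_inter hsr hw.2.1
    by_cases hc : 1 < s.card
    · refine mem_restrict.mpr ⟨⟨r, hr, w, hw.1, ?_⟩, hn⟩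
      refine h3 _ (h2 r (mem_roots.mp hr).1 w hw.1 (hn.mono hsrw)) s hs w
        (lt_of_lt_of_le hc (Finset.card_le_card hsrw)) hc
        ⟨hw.1, Finset.inter_subset_right, fun w' hw' h => hw.2.2 w' hw' (hsrw.trans h)⟩ hw
    · obtain ⟨i, hi, rfl⟩ := F.not_inner_eq hs hc
      exact mem_restrict.mpr ⟨⟨r, hr, {i}, T.leaf i hi, Finset.inter_eq_right.mpr hsr⟩, hn⟩

/-- Only the finer partition has to be admissible. Inner vertices with the same hull are traces, on
one vertex of `T`, of blocks of `P` that split this vertex, and admissibility allows a single such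
block. -/
theorem restrict_mono {T : Forest I} {P P' : Finpartition I} (hP : T.Admissible P)
    (h : P ≤ P') : T.restrict P ≤ T.restrict P' := by
  refine le_iff.mpr ⟨?_, ?_, ?_⟩
  · intro s hs
    obtain ⟨⟨B, hB, c, hc, rfl⟩, hn⟩ := mem_restrict.mp hs
    obtain ⟨B', hB', hBB'⟩ := h hB
    have := Finset.inter_subset_inter_right (u := c) hBB'
    exact ⟨B' ∩ c, mem_restrict.mpr ⟨⟨B', hB', c, hc, rfl⟩, hn.mono this⟩, this⟩
  · intro r hr w hw hn
    obtain ⟨⟨B, hB, c, hc, rfl⟩, -⟩ := mem_restrict.mp hr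
    obtain ⟨⟨D, hD, d, hd, rfl⟩, -⟩ := mem_restrict.mp hw
    refine mem_restrict.mpr ⟨?_, hn⟩
    obtain ⟨i, hi⟩ := hn
    simp only [Finset.mem_inter] at hi
    obtain ⟨B', hB', hBB'⟩ := h hB
    have := P'.eq_of_mem_parts hB' hD (hBB' hi.1.1) hi.2.1
    subst this
    have key : B ∩ c ∩ (B' ∩ d) = B ∩ (c ∩ d) := by
      ext j
      simp only [Finset.mem_inter]
      exact ⟨fun h => ⟨h.1.1, h.1.2, h.2.2⟩, fun h => ⟨⟨h.1, h.2.1⟩, hBB' h.1, h.2.2⟩⟩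
    rw [key]
    rcases T.comparable hc hd hi.1.2 hi.2.2 with h | h
    · exact ⟨B, hB, c, hc, by rw [Finset.inter_eq_left.mpr h]⟩
    · exact ⟨B, hB, d, hd, by rw [Finset.inter_eq_right.mpr h]⟩
  · intro s hs t ht w hcs hct hsw htw
    obtain ⟨⟨D, hD, e, he, rfl⟩, -⟩ := mem_restrict.mp hsw.1
    obtain ⟨a, ha, b, hb, hab, hu, hDa, hDb, hDe, -⟩ :=
      T.exists_split he (lt_of_lt_of_le hcs (Finset.card_le_card hsw.2.1))
    rw [← hDe] at hsw htw
    -- If `s` missed `a` or `b`, it would lie in the smaller cluster `D ∩ b` or `D ∩ a`, against the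
    -- minimality of the hull.
    have key : ∀ s ∈ (T.restrict P).clusters, IsHull (T.restrict P').clusters s (D ∩ (a ∪ b)) →
        ∃ B ∈ P.parts, s = B ∩ (a ∪ b) ∧ (B ∩ a).Nonempty ∧ (B ∩ b).Nonempty := by
      intro s hs hsw
      obtain ⟨⟨B, hB, c, hc, rfl⟩, hn⟩ := mem_restrict.mp hs
      have hBD : B ⊆ D := by
        obtain ⟨i, hi⟩ := hn
        obtain ⟨B', hB', hBB'⟩ := h hB
        have := P'.eq_of_mem_parts hB' hD (hBB' (Finset.mem_inter.mp hi).1)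
          (Finset.mem_inter.mp (hsw.2.1 hi)).1
        exact this ▸ hBB'
      have hne : ∀ {a b : Finset α}, a ∈ T.clusters → Disjoint a b → (D ∩ a).Nonempty →
          (D ∩ b).Nonempty → IsHull (T.restrict P').clusters (B ∩ c) (D ∩ (a ∪ b)) →
          (B ∩ c ∩ b).Nonempty := by
        intro a b ha hab hDa hDb hsw
        by_contra hn
        have h1 : B ∩ c ⊆ D ∩ a := by
          intro i hi
          have hi' := hsw.2.1 hi
          rw [Finset.mem_inter, Finset.mem_union] at hi'
          exact Finset.mem_inter.mpr ⟨hi'.1, hi'.2.resolve_right fun hib =>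
            hn ⟨i, Finset.mem_inter.mpr ⟨hi, hib⟩⟩⟩
        obtain ⟨j, hj⟩ := hDb
        rw [Finset.mem_inter] at hj
        have h2 := hsw.2.2 _ (mem_restrict.mpr ⟨⟨D, hD, a, ha, rfl⟩, hDa⟩) h1
          (Finset.mem_inter.mpr ⟨hj.1, Finset.mem_union_right a hj.2⟩)
        exact Finset.disjoint_left.mp hab (Finset.mem_inter.mp h2).2 hj.2
      have hBb := hne ha hab hDa hDb hsw
      have hBa := hne hb hab.symm hDb hDa (Finset.union_comm a b ▸ hsw)
      obtain ⟨i, hi⟩ := hBa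
      obtain ⟨j, hj⟩ := hBb
      simp only [Finset.mem_inter] at hi hj
      have hBa : (B ∩ a).Nonempty := ⟨i, Finset.mem_inter.mpr ⟨hi.1.1, hi.2⟩⟩
      have hBb : (B ∩ b).Nonempty := ⟨j, Finset.mem_inter.mpr ⟨hj.1.1, hj.2⟩⟩
      refine ⟨B, hB, ?_, hBa, hBb⟩
      have hac : a ⊆ c := (T.comparable ha hc hi.2 hi.1.2).resolve_right
        fun h => Finset.disjoint_left.mp hab (h hj.1.2) hj.2
      have hbc : b ⊆ c := (T.comparable hb hc hj.2 hj.1.2).resolve_right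
        fun h => Finset.disjoint_left.mp hab hi.2 (h hi.1.2)
      exact Finset.Subset.antisymm (Finset.subset_inter Finset.inter_subset_left
        (hsw.2.1.trans Finset.inter_subset_right))
        (Finset.inter_subset_inter_left (Finset.union_subset hac hbc))
    obtain ⟨B, hB, rfl, hBa, hBb⟩ := key s hs hsw
    obtain ⟨B', hB', rfl, hBa', hBb'⟩ := key t ht htw
    rw [hP a ha b hb hab hu B hB B' hB' hBa hBb hBa' hBb']

theorem le_roots {T : Forest I} (hT : T.IsTree) (P : Finpartition I) : P ≤ T.roots :=
  fun _ hB => ⟨I, mem_roots.mpr ⟨hT, fun t ht h => (T.subset t ht).antisymm h⟩, P.subset hB⟩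

theorem roots_parts {T : Forest I} (hT : T.IsTree) : T.roots.parts = {I} := by
  ext B
  rw [mem_roots, Finset.mem_singleton]
  constructor
  · rintro ⟨h1, h2⟩
    exact (h2 I hT (T.subset B h1)).symm
  · rintro rfl
    exact ⟨hT, fun t ht h => (T.subset t ht).antisymm h⟩

/-- The interval of forests from `F` to a tree `T` as a poset of partitions. -/
def iccEquiv {F T : Forest I} (hT : T.IsTree) (h : F ≤ T) :
    Set.Icc F T ≃o {P : Finpartition I // T.Admissible P ∧ F.roots ≤ P} where
  toFun G := ⟨G.1.roots, admissible_roots G.2.2, roots_mono G.2.1⟩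
  -- `F` and `T` are themselves restrictions of `T` to their root partitions, so both bounds are
  -- instances of `restrict_mono`.
  invFun P := ⟨T.restrict P.1,
    (restrict_roots h).ge.trans (restrict_mono (admissible_roots h) P.2.2),
    (restrict_mono P.2.1 (le_roots hT P.1)).trans (restrict_roots le_rfl).le⟩
  left_inv G := Subtype.ext (restrict_roots G.2.2)
  right_inv P := Subtype.ext (roots_restrict hT P.1)
  map_rel_iff' := by
    intro G G'
    refine ⟨fun h => ?_, fun h => roots_mono h⟩
    have := restrict_mono (admissible_roots G.2.2) (show G.1.roots ≤ G'.1.roots from h)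
    rwa [restrict_roots G.2.2, restrict_roots G'.2.2] at this

end Forest

/-! ### Coranks as numbers of trees, and merging of blocks -/

/-- A strictly decreasing `n` bounds the length of chains by its drop, and `hstep` provides chains
along which it drops by exactly one. So the height of `a` is `n ⊥ - n a`; no subtraction is
truncated, since `n` is antitone. -/
theorem corank_eq_sub {Q : Type*} [PartialOrder Q] [BoundedOrder Q] (n : Q → ℕ) (hn : StrictAnti n)
    (hstep : ∀ p q : Q, p < q → ∃ r, p ≤ r ∧ r ≤ q ∧ n r + 1 = n p) (a : Q) :
    corank a = n a - n ⊤ := by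
  have upper : ∀ (m : ℕ) (a : Q), n ⊥ - n a = m → Order.height a ≤ (m : ℕ∞) := by
    intro m
    induction m using Nat.strong_induction_on with
    | _ m ih =>
      intro a ha
      rw [Order.height_le_coe_iff]
      intro y hy
      have h1 := hn hy
      have h2 := hn.antitone (bot_le : ⊥ ≤ y)
      have h3 : n ⊥ - n y < m := by omega
      exact lt_of_le_of_lt (ih _ h3 y rfl) (by exact_mod_cast h3)
  have lower : ∀ (k : ℕ) (p q : Q), p ≤ q → n p = n q + k →
      Order.height p + (k : ℕ∞) ≤ Order.height q := by
    intro k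
    induction k with
    | zero => intro p q hpq _; simpa using Order.height_mono hpq
    | succ k ih =>
      intro p q hpq h
      obtain ⟨r, hpr, hrq, hr⟩ := hstep p q (lt_of_le_of_ne hpq (by rintro rfl; omega))
      have hlt : p < r := lt_of_le_of_ne hpr (by rintro rfl; omega)
      have := ih r q hrq (by omega)
      refine le_trans ?_ this
      rw [Nat.cast_add, Nat.cast_one, add_comm (k : ℕ∞) 1, ← add_assoc]
      gcongr
      exact Order.height_add_one_le hlt
  have hh : ∀ a : Q, Order.height a = ((n ⊥ - n a : ℕ) : ℕ∞) := by
    intro a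
    refine le_antisymm (upper _ a rfl) ?_
    have h := hn.antitone (bot_le : ⊥ ≤ a)
    simpa using lower (n ⊥ - n a) ⊥ a bot_le (by omega)
  have h1 := hn.antitone (bot_le : ⊥ ≤ a)
  have h2 := hn.antitone (le_top : a ≤ ⊤)
  rw [corank, hh, hh, ENat.toNat_natCast, ENat.toNat_natCast]
  omega

namespace Forest

variable {α : Type*} [DecidableEq α] {I : Finset α}

theorem union_subset_of_inter (T : Forest I) {a b w : Finset α} (ha : a ∈ T.clusters)
    (hb : b ∈ T.clusters) (hab : Disjoint a b) (hw : w ∈ T.clusters) {i j : α}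
    (hia : i ∈ a) (hiw : i ∈ w) (hjb : j ∈ b) (hjw : j ∈ w) : a ∪ b ⊆ w := by
  refine Finset.union_subset ?_ ?_
  · exact (T.comparable ha hw hia hiw).resolve_right
      fun h => Finset.disjoint_left.mp hab (h hjw) hjb
  · exact (T.comparable hb hw hjb hjw).resolve_right
      fun h => Finset.disjoint_left.mp hab hia (h hiw)

/-- The vertex `x ∪ y` is the hull of `v ∪ w`. If `v` were not on one side, it would contain `x ∪ y`
and hence `w`; if both were on the same side, the hull would be smaller. -/
theorem exists_split_of_disjoint {T : Forest I} (hT : T.IsTree) {v w : Finset α}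
    (hv : v ∈ T.clusters) (hw : w ∈ T.clusters) (hvw : Disjoint v w) :
    ∃ x ∈ T.clusters, ∃ y ∈ T.clusters, Disjoint x y ∧ x ∪ y ∈ T.clusters ∧ v ⊆ x ∧ w ⊆ y := by
  obtain ⟨i, hi⟩ := T.nonempty v hv
  obtain ⟨j, hj⟩ := T.nonempty w hw
  have hI : (v ∪ w) ∩ I = v ∪ w :=
    Finset.inter_eq_left.mpr (Finset.union_subset (T.subset v hv) (T.subset w hw))
  have hcard : 1 < ((v ∪ w) ∩ I).card := by
    rw [hI]
    refine Finset.one_lt_card.mpr ⟨i, Finset.mem_union_left _ hi, j, Finset.mem_union_right _ hj, ?_⟩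
    rintro rfl
    exact Finset.disjoint_left.mp hvw hi hj
  obtain ⟨x, hx, y, hy, hxy, hu, hx', hy', h, -⟩ := T.exists_split hT hcard
  rw [hI, Finset.inter_eq_left] at h
  have side : ∀ {v w : Finset α}, v ∈ T.clusters → w ∈ T.clusters → Disjoint v w → v ∪ w ⊆ x ∪ y →
      v ⊆ x ∨ v ⊆ y := by
    intro v w hv hw hvw h
    by_contra hn
    rw [not_or, Finset.not_subset, Finset.not_subset] at hn
    obtain ⟨⟨k, hk, hkx⟩, ⟨l, hl, hly⟩⟩ := hn
    have hky := (Finset.mem_union.mp (h (Finset.mem_union_left _ hk))).resolve_left hkx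
    have hlx := (Finset.mem_union.mp (h (Finset.mem_union_left _ hl))).resolve_right hly
    have := T.union_subset_of_inter hx hy hxy hv hlx hl hky hk
    obtain ⟨m, hm⟩ := T.nonempty w hw
    exact Finset.disjoint_left.mp hvw (this (h (Finset.mem_union_right _ hm))) hm
  have out : ∀ {x y : Finset α}, Disjoint x y → ((v ∪ w) ∩ y).Nonempty → v ⊆ x → w ⊆ x → False := by
    intro x y hxy hn hvx hwx
    obtain ⟨k, hk⟩ := hn
    rw [Finset.mem_inter] at hk
    exact Finset.disjoint_left.mp hxy (Finset.union_subset hvx hwx hk.1) hk.2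
  rcases side hv hw hvw h with h1 | h1 <;>
    rcases side hw hv hvw.symm (Finset.union_comm v w ▸ h) with h2 | h2
  · exact (out hxy hy' h1 h2).elim
  · exact ⟨x, hx, y, hy, hxy, hu, h1, h2⟩
  · exact ⟨y, hy, x, hx, hxy.symm, Finset.union_comm x y ▸ hu, h1, h2⟩
  · exact (out hxy.symm hx' h1 h2).elim

end Forest

/-- The partition obtained by merging two blocks. -/
def Finpartition.merge {α : Type*} [DecidableEq α] {I : Finset α} (P : Finpartition I)
    {B B' : Finset α} (hB : B ∈ P.parts) (hB' : B' ∈ P.parts) : Finpartition I :=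
  Finpartition.ofExistsUnique (insert (B ∪ B') ((P.parts.erase B).erase B'))
    (by
      intro D hD
      simp only [Finset.mem_insert, Finset.mem_erase] at hD
      rcases hD with rfl | hD
      · exact Finset.union_subset (P.subset hB) (P.subset hB')
      · exact P.subset hD.2.2)
    (by
      intro i hi
      obtain ⟨D, hD, hiD⟩ := P.exists_mem hi
      simp only [Finset.mem_insert, Finset.mem_erase]
      by_cases h : D = B ∨ D = B'
      · have hiU : i ∈ B ∪ B' := by
          rcases h with rfl | rfl
          · exact Finset.mem_union_left _ hiD
          · exact Finset.mem_union_right _ hiD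
        refine ⟨B ∪ B', ⟨Or.inl rfl, hiU⟩, ?_⟩
        rintro E ⟨rfl | hE, hiE⟩
        · rfl
        · have := P.eq_of_mem_parts hD hE.2.2 hiD hiE
          subst this
          exact (h.elim hE.2.1 hE.1).elim
      · rw [not_or] at h
        refine ⟨D, ⟨Or.inr ⟨h.2, h.1, hD⟩, hiD⟩, ?_⟩
        rintro E ⟨rfl | hE, hiE⟩
        · rcases Finset.mem_union.mp hiE with h' | h'
          · exact (h.1 (P.eq_of_mem_parts hD hB hiD h')).elim
          · exact (h.2 (P.eq_of_mem_parts hD hB' hiD h')).elim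
        · exact P.eq_of_mem_parts hE.2.2 hD hiE hiD)
    (by
      intro h
      simp only [Finset.mem_insert, Finset.mem_erase] at h
      rcases h with h | h
      · obtain ⟨i, hi⟩ := P.nonempty_of_mem_parts hB
        exact Finset.notMem_empty i (h ▸ Finset.mem_union_left _ hi)
      · exact P.empty_notMem_parts h.2.2)

namespace Finpartition

variable {α : Type*} [DecidableEq α] {I : Finset α} {P : Finpartition I} {B B' : Finset α}

theorem mem_merge (hB : B ∈ P.parts) (hB' : B' ∈ P.parts) {D : Finset α} :
    D ∈ (P.merge hB hB').parts ↔ D = B ∪ B' ∨ D ≠ B' ∧ D ≠ B ∧ D ∈ P.parts := by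
  change D ∈ insert (B ∪ B') ((P.parts.erase B).erase B') ↔ _
  simp only [Finset.mem_insert, Finset.mem_erase]

theorem le_merge (hB : B ∈ P.parts) (hB' : B' ∈ P.parts) : P ≤ P.merge hB hB' := by
  intro D hD
  by_cases h : D = B
  · exact ⟨B ∪ B', (mem_merge hB hB').mpr (Or.inl rfl), h ▸ Finset.subset_union_left⟩
  by_cases h' : D = B'
  · exact ⟨B ∪ B', (mem_merge hB hB').mpr (Or.inl rfl), h' ▸ Finset.subset_union_right⟩
  · exact ⟨D, (mem_merge hB hB').mpr (Or.inr ⟨h', h, hD⟩), le_rfl⟩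

theorem merge_le {Q : Finpartition I} (h : P ≤ Q) {C : Finset α} (hC : C ∈ Q.parts)
    (hB : B ∈ P.parts) (hB' : B' ∈ P.parts) (hBC : B ⊆ C) (hBC' : B' ⊆ C) :
    P.merge hB hB' ≤ Q := by
  intro D hD
  rcases (mem_merge hB hB').mp hD with rfl | hD
  · exact ⟨C, hC, Finset.union_subset hBC hBC'⟩
  · exact h hD.2.2

theorem card_merge (hB : B ∈ P.parts) (hB' : B' ∈ P.parts) (hne : B ≠ B') :
    (P.merge hB hB').parts.card + 1 = P.parts.card := by
  change (insert (B ∪ B') ((P.parts.erase B).erase B')).card + 1 = _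
  have h1 : B ∪ B' ∉ (P.parts.erase B).erase B' := by
    intro h
    simp only [Finset.mem_erase] at h
    obtain ⟨i, hi⟩ := P.nonempty_of_mem_parts hB
    exact h.2.1 (P.eq_of_mem_parts h.2.2 hB (Finset.mem_union_left _ hi) hi)
  have h2 : B' ∈ P.parts.erase B := Finset.mem_erase.mpr ⟨hne.symm, hB'⟩
  rw [Finset.card_insert_of_notMem h1, Finset.card_erase_add_one h2, Finset.card_erase_add_one hB]

theorem subset_of_mem {Q : Finpartition I} (h : P ≤ Q) {C : Finset α} (hC : C ∈ Q.parts)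
    (hB : B ∈ P.parts) {i : α} (hiB : i ∈ B) (hiC : i ∈ C) : B ⊆ C := by
  obtain ⟨D, hD, hBD⟩ := h hB
  exact Q.eq_of_mem_parts hD hC (hBD hiB) hiC ▸ hBD

end Finpartition

namespace Forest

variable {α : Type*} [DecidableEq α] {I : Finset α}

/-- If every vertex of `T` that is split by a block `C` of `Q` is split by a block of the finer
partition `P`, then `C` is contained in a block of `P`. -/
theorem exists_subset_of_split {T : Forest I} {P Q : Finpartition I} (hQ : T.Admissible Q)
    (hPQ : P ≤ Q) {C : Finset α} (hC : C ∈ Q.parts)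
    (h : ∀ a ∈ T.clusters, ∀ b ∈ T.clusters, Disjoint a b → a ∪ b ∈ T.clusters →
      (C ∩ a).Nonempty → (C ∩ b).Nonempty →
        ∃ B ∈ P.parts, (B ∩ a).Nonempty ∧ (B ∩ b).Nonempty) :
    ∀ (n : ℕ) (w : Finset α), w.card = n → w ∈ T.clusters → (C ∩ w).Nonempty →
      ∃ B ∈ P.parts, C ∩ w ⊆ B := by
  intro n
  induction n using Nat.strong_induction_on with
  | _ n ih =>
    intro w hn hw hne
    by_cases hc : 1 < w.card
    · obtain ⟨a, ha, b, hb, hab, hu⟩ := T.binary w hw hc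
      have hca := T.card_lt_of_union_eq hb hab hu
      have hcb := T.card_lt_of_union_eq ha hab.symm ((Finset.union_comm b a).trans hu)
      by_cases h1 : (C ∩ a).Nonempty
      · obtain ⟨B₁, hB₁, hs₁⟩ := ih _ (hn ▸ hca) a rfl ha h1
        by_cases h2 : (C ∩ b).Nonempty
        · obtain ⟨B₂, hB₂, hs₂⟩ := ih _ (hn ▸ hcb) b rfl hb h2
          obtain ⟨B, hB, hBa, hBb⟩ := h a ha b hb hab (hu ▸ hw) h1 h2
          -- `C` and the block of `Q` around `B` split the same vertex, so they agree by
          -- admissibility. Thus `B` meets both traces of `C`, which glues `B₁` and `B₂` to `B`.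
          have hBC : B ⊆ C := by
            obtain ⟨D, hD, hBD⟩ := hPQ hB
            have := hQ a ha b hb hab (hu ▸ hw) D hD C hC
              (hBa.mono (Finset.inter_subset_inter_right hBD))
              (hBb.mono (Finset.inter_subset_inter_right hBD)) h1 h2
            exact this ▸ hBD
          obtain ⟨i, hi⟩ := hBa
          obtain ⟨j, hj⟩ := hBb
          rw [Finset.mem_inter] at hi hj
          have e1 := P.eq_of_mem_parts hB hB₁ hi.1 (hs₁ (Finset.mem_inter.mpr ⟨hBC hi.1, hi.2⟩))
          have e2 := P.eq_of_mem_parts hB hB₂ hj.1 (hs₂ (Finset.mem_inter.mpr ⟨hBC hj.1, hj.2⟩))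
          refine ⟨B, hB, ?_⟩
          rw [← hu, Finset.inter_union_distrib_left]
          exact Finset.union_subset (e1 ▸ hs₁) (e2 ▸ hs₂)
        · refine ⟨B₁, hB₁, ?_⟩
          rw [← hu, Finset.inter_union_distrib_left, Finset.not_nonempty_iff_eq_empty.mp h2,
            Finset.union_empty]
          exact hs₁
      · rw [← hu, Finset.inter_union_distrib_left, Finset.not_nonempty_iff_eq_empty.mp h1,
          Finset.empty_union] at hne ⊢
        exact ih _ (hn ▸ hcb) b rfl hb hne
    · obtain ⟨i, hi, rfl⟩ := T.not_inner_eq hw hc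
      obtain ⟨B, hB, hiB⟩ := P.exists_mem hi
      exact ⟨B, hB, Finset.inter_subset_right.trans (Finset.singleton_subset_iff.mpr hiB)⟩

/-- A violation can only come from a vertex `c ∪ d` split by a third block `D` and by the union `B ∪
B'`. If `B` or `B'` alone splits it, `P` is violated already; the case left is that one of them
meets `c` and the other meets `d`. -/
theorem Admissible.merge {T : Forest I} (hT : T.IsTree) {P : Finpartition I}
    (hP : T.Admissible P) {a b B B' : Finset α} (ha : a ∈ T.clusters) (hb : b ∈ T.clusters)
    (hab : Disjoint a b) (hu : a ∪ b ∈ T.clusters)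
    (hnone : ∀ D ∈ P.parts, ¬ ((D ∩ a).Nonempty ∧ (D ∩ b).Nonempty))
    (hB : B ∈ P.parts) (hB' : B' ∈ P.parts) (hBa : (B ∩ a).Nonempty) (hBb : (B' ∩ b).Nonempty) :
    T.Admissible (P.merge hB hB') := by
  have hnone : ∀ D ∈ P.parts, ∀ x ∈ D, ∀ y ∈ D, x ∈ a → y ∈ b → False :=
    fun D hD x hx y hy hxa hyb => hnone D hD
      ⟨⟨x, Finset.mem_inter.mpr ⟨hx, hxa⟩⟩, ⟨y, Finset.mem_inter.mpr ⟨hy, hyb⟩⟩⟩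
  obtain ⟨i, hi⟩ := hBa
  obtain ⟨j, hj⟩ := hBb
  rw [Finset.mem_inter] at hi hj
  obtain ⟨hiB, hia⟩ := hi
  obtain ⟨hjB, hjb⟩ := hj
  have mi : ∀ {x : α} {s t : Finset α}, x ∈ s → x ∈ t → (s ∩ t).Nonempty :=
    fun h h' => ⟨_, Finset.mem_inter.mpr ⟨h, h'⟩⟩
  -- As `D` already splits `c ∪ d`, the block `B` misses `d` and `B'` misses `c`. The position of `c
  -- ∪ d` relative to `a ∪ b` then decides.
  have cross : ∀ {c d : Finset α}, c ∈ T.clusters → d ∈ T.clusters → Disjoint c d →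
      c ∪ d ∈ T.clusters → ∀ {D : Finset α}, D ∈ P.parts → D ≠ B' → D ≠ B →
      (D ∩ c).Nonempty → (D ∩ d).Nonempty → ∀ {k l : α}, k ∈ B → l ∈ B' → k ∈ c → l ∈ d →
      False := by
    intro c d hc hd hcd hcdu D hD hDB' hDB hDc hDd k l hkB hlB hkc hld
    have hBd : ∀ x ∈ B, x ∈ d → False := fun x hx hxd =>
      hDB (hP c hc d hd hcd hcdu D hD B hB hDc hDd (mi hkB hkc) (mi hx hxd))
    have hBc : ∀ x ∈ B', x ∈ c → False := fun x hx hxc =>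
      hDB' (hP c hc d hd hcd hcdu D hD B' hB' hDc hDd (mi hx hxc) (mi hlB hld))
    -- Here `k ∈ a` and `l ∈ b`. Since `D` does not split `a ∪ b`, one of `c`, `d` meets both `a`
    -- and `b`, hence contains both and meets the other.
    have hsub : c ∪ d ⊆ a ∪ b → False := by
      intro hsub
      have hka : k ∈ a := (Finset.mem_union.mp (hsub (Finset.mem_union_left _ hkc))).resolve_right
        fun h => hnone B hB i hiB k hkB hia h
      have hlb : l ∈ b := (Finset.mem_union.mp (hsub (Finset.mem_union_right _ hld))).resolve_left
        fun h => hnone B' hB' l hlB j hjB h hjb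
      obtain ⟨x, hx⟩ := hDc
      obtain ⟨y, hy⟩ := hDd
      rw [Finset.mem_inter] at hx hy
      rcases Finset.mem_union.mp (hsub (Finset.mem_union_right _ hy.2)) with hya | hyb
      · have := T.union_subset_of_inter ha hb hab hd hya hy.2 hlb hld
        exact Finset.disjoint_left.mp hcd hkc (this (Finset.mem_union_left _ hka))
      · rcases Finset.mem_union.mp (hsub (Finset.mem_union_left _ hx.2)) with hxa | hxb
        · exact hnone D hD x hx.1 y hy.1 hxa hyb
        · have := T.union_subset_of_inter ha hb hab hc hka hkc hxb hx.2
          exact Finset.disjoint_left.mp hcd (this (Finset.mem_union_right _ hlb)) hld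
    rcases T.laminar _ hcdu _ hu with h | h | h
    · exact hsub h
    · have hic : i ∈ c := (Finset.mem_union.mp (h (Finset.mem_union_left _ hia))).resolve_right
        (hBd i hiB)
      have hjd : j ∈ d := (Finset.mem_union.mp (h (Finset.mem_union_right _ hjb))).resolve_left
        (hBc j hjB)
      exact hsub (T.union_subset_of_inter hc hd hcd hu hic (Finset.mem_union_left _ hia) hjd
        (Finset.mem_union_right _ hjb))
    -- In the disjoint case `B` and `B'` both split the vertex where `c ∪ d` and `a ∪ b` join, so
    -- they are equal and split `a ∪ b`.
    · obtain ⟨x, hx, y, hy, hxy, hxyu, hcx, hay⟩ := exists_split_of_disjoint hT hcdu hu h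
      have hBB := hP x hx y hy hxy hxyu B hB B' hB'
        (mi hkB (hcx (Finset.mem_union_left _ hkc))) (mi hiB (hay (Finset.mem_union_left _ hia)))
        (mi hlB (hcx (Finset.mem_union_right _ hld))) (mi hjB (hay (Finset.mem_union_right _ hjb)))
      exact hnone B hB i hiB j (hBB ▸ hjB) hia hjb
  have merged : ∀ {c d : Finset α}, c ∈ T.clusters → d ∈ T.clusters → Disjoint c d →
      c ∪ d ∈ T.clusters → ∀ {D : Finset α}, D ∈ P.parts → D ≠ B' → D ≠ B →
      (D ∩ c).Nonempty → (D ∩ d).Nonempty → ((B ∪ B') ∩ c).Nonempty →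
      ((B ∪ B') ∩ d).Nonempty → False := by
    intro c d hc hd hcd hcdu D hD hDB' hDB hDc hDd hBc hBd
    obtain ⟨k, hk⟩ := hBc
    obtain ⟨l, hl⟩ := hBd
    rw [Finset.mem_inter, Finset.mem_union] at hk hl
    rcases hk with ⟨hk | hk, hkc⟩ <;> rcases hl with ⟨hl | hl, hld⟩
    · exact hDB (hP c hc d hd hcd hcdu D hD B hB hDc hDd (mi hk hkc) (mi hl hld))
    · exact cross hc hd hcd hcdu hD hDB' hDB hDc hDd hk hl hkc hld
    · exact cross hd hc hcd.symm (Finset.union_comm c d ▸ hcdu) hD hDB' hDB hDd hDc hl hk hld hkc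
    · exact hDB' (hP c hc d hd hcd hcdu D hD B' hB' hDc hDd (mi hk hkc) (mi hl hld))
  intro c hc d hd hcd hcdu D hD D' hD' hDc hDd hDc' hDd'
  rw [Finpartition.mem_merge] at hD hD'
  rcases hD with rfl | hD <;> rcases hD' with rfl | hD'
  · rfl
  · exact (merged hc hd hcd hcdu hD'.2.2 hD'.1 hD'.2.1 hDc' hDd' hDc hDd).elim
  · exact (merged hc hd hcd hcdu hD.2.2 hD.1 hD.2.1 hDc hDd hDc' hDd').elim
  · exact hP c hc d hd hcd hcdu D hD.2.2 D' hD'.2.2 hDc hDd hDc' hDd'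

/-- If each vertex split by a block of `Q` were split by a block of `P`, then `Q ≤ P` by
`exists_subset_of_split`. So some block `C` of `Q` splits a vertex that no block of `P` splits; two
blocks of `P` inside `C`, one on each side of this vertex, can be merged. -/
theorem exists_admissible_merge {T : Forest I} (hT : T.IsTree) {P Q : Finpartition I}
    (hP : T.Admissible P) (hQ : T.Admissible Q) (h : P < Q) :
    ∃ R, T.Admissible R ∧ P ≤ R ∧ R ≤ Q ∧ R.parts.card + 1 = P.parts.card := by
  have hex : ∃ C ∈ Q.parts, ∃ a ∈ T.clusters, ∃ b ∈ T.clusters, Disjoint a b ∧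
      a ∪ b ∈ T.clusters ∧ (C ∩ a).Nonempty ∧ (C ∩ b).Nonempty ∧
      ∀ B ∈ P.parts, ¬ ((B ∩ a).Nonempty ∧ (B ∩ b).Nonempty) := by
    by_contra hn
    refine h.not_ge fun C hC => ?_
    have hI : C ∩ I = C := Finset.inter_eq_left.mpr (Q.subset hC)
    have := exists_subset_of_split hQ h.le hC ?_ _ I rfl hT
      (hI.symm ▸ Q.nonempty_of_mem_parts hC)
    · rwa [hI] at this
    · intro a ha b hb hab hu hCa hCb
      by_contra hn'
      exact hn ⟨C, hC, a, ha, b, hb, hab, hu, hCa, hCb, fun B hB hBab => hn' ⟨B, hB, hBab⟩⟩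
  obtain ⟨C, hC, a, ha, b, hb, hab, hu, ⟨i, hi⟩, ⟨j, hj⟩, hnone⟩ := hex
  rw [Finset.mem_inter] at hi hj
  obtain ⟨B, hB, hiB⟩ := P.exists_mem (Q.subset hC hi.1)
  obtain ⟨B', hB', hjB⟩ := P.exists_mem (Q.subset hC hj.1)
  have hBa : (B ∩ a).Nonempty := ⟨i, Finset.mem_inter.mpr ⟨hiB, hi.2⟩⟩
  have hBb : (B' ∩ b).Nonempty := ⟨j, Finset.mem_inter.mpr ⟨hjB, hj.2⟩⟩
  refine ⟨P.merge hB hB', hP.merge hT ha hb hab hu hnone hB hB' hBa hBb,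
    Finpartition.le_merge hB hB', Finpartition.merge_le h.le hC hB hB'
      (Finpartition.subset_of_mem h.le hC hB hiB hi.1)
      (Finpartition.subset_of_mem h.le hC hB' hjB hj.1), Finpartition.card_merge hB hB' ?_⟩
  rintro rfl
  exact hnone B hB ⟨hBa, hBb⟩

/-- The corank of a forest in an interval below a tree is the number of its trees minus one. -/
theorem corank_add_one {F T : Forest I} (hT : T.IsTree) [h : Fact (F ≤ T)] (G : Set.Icc F T) :
    corank G + 1 = G.1.roots.parts.card := by
  have hstep : ∀ p q : Set.Icc F T, p < q → ∃ r, p ≤ r ∧ r ≤ q ∧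
      r.1.roots.parts.card + 1 = p.1.roots.parts.card := by
    intro p q hpq
    obtain ⟨R, hR, h1, h2, h3⟩ := exists_admissible_merge hT (admissible_roots p.2.2)
      (admissible_roots q.2.2) ((iccEquiv hT h.out).strictMono hpq)
    let R' : {P : Finpartition I // T.Admissible P ∧ F.roots ≤ P} :=
      ⟨R, hR, (roots_mono p.2.1).trans h1⟩
    refine ⟨(iccEquiv hT h.out).symm R', ?_, ?_, ?_⟩
    · rw [OrderIso.le_symm_apply]; exact h1
    · rw [OrderIso.symm_apply_le]; exact h2
    · have : ((iccEquiv hT h.out).symm R').1.roots = R := roots_restrict hT R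
      rw [this, h3]
  have hanti : StrictAnti fun G : Set.Icc F T => G.1.roots.parts.card := by
    intro p q hpq
    obtain ⟨r, -, hrq, hr⟩ := hstep p q hpq
    have := Finpartition.card_mono (roots_mono (show r.1 ≤ q.1 from hrq))
    change q.1.roots.parts.card < p.1.roots.parts.card
    omega
  have htop : (⊤ : Set.Icc F T).1.roots.parts.card = 1 := by
    change T.roots.parts.card = 1
    rw [roots_parts hT, Finset.card_singleton]
  have hle := hanti.antitone (le_top : G ≤ ⊤)
  simp only [htop] at hle
  -- The one in the statement is the single block of `T`.
  rw [corank_eq_sub _ hanti hstep G, htop]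
  omega

end Forest

/-! ### The Möbius recursion and the `M`-polynomial -/

open Classical in
/-- The recursion that characterizes the Möbius function of an order relation `r`. -/
def IsMoebius {X : Type*} [Fintype X] (r : X → X → Prop) (g : X → X → ℤ) : Prop :=
  (∀ x y, ¬ r x y → g x y = 0) ∧
    ∀ x y, ∑ z ∈ Finset.univ.filter (r x), g z y = if x = y then 1 else 0

/-- The recursion may run over everything above `x` instead of the interval from `x` to `y`, because
the additional terms vanish. -/
theorem isMoebius_mu {Q : Type*} [PartialOrder Q] [Fintype Q] [LocallyFiniteOrder Q]
    [DecidableEq Q] : IsMoebius (· ≤ · : Q → Q → Prop) (fun x y => IncidenceAlgebra.mu ℤ x y) := by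
  classical
  refine ⟨fun x y h => IncidenceAlgebra.apply_eq_zero_of_not_le h _, fun x y => ?_⟩
  have := IncidenceAlgebra.sum_Icc_mu_left (𝕜 := ℤ) x y
  trans ∑ z ∈ Finset.Icc x y, IncidenceAlgebra.mu ℤ z y
  · refine (Finset.sum_subset (fun z hz => ?_) fun z hz hz' => ?_).symm
    · exact Finset.mem_filter.mpr ⟨Finset.mem_univ z, (Finset.mem_Icc.mp hz).1⟩
    · refine IncidenceAlgebra.apply_eq_zero_of_not_le (fun h => hz' ?_) _
      exact Finset.mem_Icc.mpr ⟨(Finset.mem_filter.mp hz).2, h⟩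
  · rw [this]
    congr

theorem exists_isMoebius (Q : Type*) [PartialOrder Q] [Fintype Q] :
    ∃ g : Q → Q → ℤ, IsMoebius (· ≤ ·) g := by
  classical
  let : LocallyFiniteOrder Q := Fintype.toLocallyFiniteOrder
  exact ⟨_, isMoebius_mu⟩

/-- Solutions of the recursion on isomorphic posets agree. -/
theorem IsMoebius.unique {X Q : Type*} [Fintype X] [Fintype Q] [PartialOrder Q] (e : X ≃ Q)
    {m : Q → Q → ℤ} (hm : IsMoebius (· ≤ ·) m) {g : X → X → ℤ}
    (hg : IsMoebius (fun x y => e x ≤ e y) g) (x y : X) : m (e x) (e y) = g x y := by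
  classical
  -- The recursion expresses the value at `x` by the values at larger elements, so the induction
  -- descends from the top.
  induction hx : e x using WellFoundedGT.induction generalizing x with
  | _ q ih =>
    subst hx
    have h3 : ∑ z ∈ Finset.univ.filter (fun z => e x ≤ e z), m (e z) (e y)
        = ∑ z ∈ Finset.univ.filter (fun z => e x ≤ e z), g z y := by
      have h1 := hm.2 (e x) (e y)
      have h2 := hg.2 x y
      rw [Finset.sum_filter, ← e.sum_comp] at h1
      rw [Finset.sum_filter]
      simp only [e.injective.eq_iff] at h1
      rw [h1, h2]
    have hmem : x ∈ Finset.univ.filter (fun z => e x ≤ e z) :=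
      Finset.mem_filter.mpr ⟨Finset.mem_univ x, le_refl _⟩
    rw [← Finset.add_sum_erase _ _ hmem, ← Finset.add_sum_erase _ (fun z => g z y) hmem] at h3
    have h4 : ∀ z ∈ (Finset.univ.filter fun z => e x ≤ e z).erase x, m (e z) (e y) = g z y := by
      intro z hz
      rw [Finset.mem_erase, Finset.mem_filter] at hz
      exact ih _ (lt_of_le_of_ne hz.2.2 fun h => hz.1 (e.injective h).symm) z rfl
    rw [Finset.sum_congr rfl h4] at h3
    exact add_right_cancel h3

open MvPolynomial in
/-- The `M`-polynomial in terms of any solution of the recursion of the Möbius function. -/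
theorem mPolynomial_eq_sum {Q : Type*} [PartialOrder Q] [BoundedOrder Q] [Finite Q]
    {Y : Type*} [Fintype Y] (e : Y ≃ Q) {g : Y → Y → ℤ}
    (hg : IsMoebius (fun x y => e x ≤ e y) g) :
    mPolynomial Q = ∑ x, ∑ y, C (g x y) * X 0 ^ corank (e x) * X 1 ^ corank (e y) := by
  classical
  let : Fintype Q := Fintype.ofFinite Q
  let : LocallyFiniteOrder Q := Fintype.toLocallyFiniteOrder
  have h : mPolynomial Q = ∑ a : Q, ∑ b ∈ Finset.univ.filter (fun b : Q => a ≤ b),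
      C (IncidenceAlgebra.mu ℤ a b) * X 0 ^ corank a * X 1 ^ corank b := by
    rw [mPolynomial]
  rw [h, ← e.sum_comp]
  refine Finset.sum_congr rfl fun x _ => ?_
  rw [Finset.sum_filter, ← e.sum_comp]
  refine Finset.sum_congr rfl fun y _ => ?_
  split_ifs with hxy
  · rw [isMoebius_mu.unique e hg]
  · rw [hg.1 x y hxy, C_0, zero_mul, zero_mul]

theorem IsMoebius.prod {A B : Type*} [PartialOrder A] [PartialOrder B] [Fintype A] [Fintype B]
    {g : A → A → ℤ} {h : B → B → ℤ} (hg : IsMoebius (· ≤ ·) g) (hh : IsMoebius (· ≤ ·) h) :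
    IsMoebius (· ≤ · : A × B → A × B → Prop) (fun p q => g p.1 q.1 * h p.2 q.2) := by
  classical
  constructor
  · rintro ⟨a, b⟩ ⟨c, d⟩ hn
    have hn : ¬ (a, b) ≤ (c, d) := hn
    rw [Prod.mk_le_mk, not_and_or] at hn
    rcases hn with hn | hn
    · simp [hg.1 _ _ hn]
    · simp [hh.1 _ _ hn]
  · rintro ⟨a, b⟩ ⟨c, d⟩
    have h1 := hg.2 a c
    have h2 := hh.2 b d
    have : Finset.univ.filter (fun p : A × B => (a, b) ≤ p) =
        Finset.univ.filter (fun x => a ≤ x) ×ˢ Finset.univ.filter (fun y => b ≤ y) := by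
      ext ⟨x, y⟩
      simp
    trans ∑ p ∈ Finset.univ.filter (fun p : A × B => (a, b) ≤ p), g p.1 c * h p.2 d
    · congr!
    rw [this, Finset.sum_product]
    dsimp only
    rw [← Finset.sum_mul_sum]
    trans (if a = c then 1 else 0) * (if b = d then 1 else 0)
    · rw [← h1, ← h2]
    by_cases hac : a = c <;> by_cases hbd : b = d <;> simp [hac, hbd]

/-! ### The poset of pairs with an optional graft -/

section Graft

open Classical in
/-- The Möbius function of the poset of pairs `(p, o)` with `p ∈ A` and `o` either empty or an
element of `τ p`. -/
noncomputable def graftMoebius {A β : Type*} [PartialOrder A] [PartialOrder β] {τ : A → Finset β}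
    (g : A → A → ℤ) : (Σ p : A, Option (τ p)) → (Σ p : A, Option (τ p)) → ℤ
  | ⟨p, none⟩, ⟨q, none⟩ => g p q
  | ⟨p, none⟩, ⟨q, some t⟩ => -(g p q * ∑ s : τ p, if s.1 ≤ t.1 then 1 else 0)
  | ⟨_, some _⟩, ⟨_, none⟩ => 0
  | ⟨p, some s⟩, ⟨q, some t⟩ => if s.1 ≤ t.1 then g p q else 0

variable {A β : Type*} [PartialOrder A] [PartialOrder β] [Fintype A] {τ : A → Finset β}
  {g : A → A → ℤ}

/-- Between grafted elements, `hτ` leaves exactly one choice of graft over each larger base element,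
so the recursion is that of `A`. The value from an ungrafted to a grafted element is chosen so that
the sum over each fibre vanishes. -/
theorem isMoebius_graftMoebius (hg : IsMoebius (· ≤ ·) g)
    (hτ : ∀ p q, p ≤ q → ∀ s ∈ τ p, ∃! t, t ∈ τ q ∧ s ≤ t)
    {r : (Σ p : A, Option (τ p)) → (Σ p : A, Option (τ p)) → Prop}
    (h0 : ∀ p x, r ⟨p, none⟩ x ↔ p ≤ x.1)
    (h1 : ∀ p s q, ¬ r ⟨p, some s⟩ ⟨q, none⟩)
    (h2 : ∀ p s q t, r ⟨p, some s⟩ ⟨q, some t⟩ ↔ p ≤ q ∧ s.1 ≤ t.1) :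
    IsMoebius r (graftMoebius g) := by
  classical
  have huniq : ∀ {p q : A}, p ≤ q → ∀ {s t t' : β}, s ∈ τ p → t ∈ τ q → t' ∈ τ q → s ≤ t → s ≤ t' →
      t = t' := fun hpq _ _ _ hs ht ht' hst hst' =>
    (hτ _ _ hpq _ hs).unique ⟨ht, hst⟩ ⟨ht', hst'⟩
  constructor
  · rintro ⟨p, _ | s⟩ ⟨q, _ | t⟩ hn
    · exact hg.1 p q fun h => hn ((h0 _ _).mpr h)
    · have : g p q = 0 := hg.1 p q fun h => hn ((h0 _ _).mpr h)
      simp [graftMoebius, this]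
    · rfl
    · simp only [graftMoebius]
      split_ifs with hst
      · exact hg.1 p q fun h => hn ((h2 _ _ _ _).mpr ⟨h, hst⟩)
      · rfl
  · rintro ⟨p, _ | s⟩ ⟨q, _ | t⟩
    · have := hg.2 p q
      rw [Finset.sum_filter] at this ⊢
      rw [Fintype.sum_sigma]
      simp only [Fintype.sum_option, h0, graftMoebius, ite_self, Finset.sum_const_zero, add_zero]
      rw [this]
      by_cases hpq : p = q
      · subst hpq; simp
      · simp [hpq]
    · rw [Finset.sum_filter, Fintype.sum_sigma]
      simp only [Fintype.sum_option, h0, graftMoebius]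
      rw [if_neg (by rintro ⟨⟩)]
      -- Over each `c`, the ungrafted term is minus the sum of the grafted ones.
      refine Finset.sum_eq_zero fun c _ => ?_
      by_cases hpc : p ≤ c
      · simp only [hpc, if_true, Finset.mul_sum, mul_ite, mul_one, mul_zero]
        exact neg_add_cancel _
      · simp [hpc]
    · rw [Finset.sum_filter, Fintype.sum_sigma]
      simp only [Fintype.sum_option, h1, graftMoebius, ite_self, Finset.sum_const_zero, add_zero,
        if_false]
      rw [if_neg (by rintro ⟨⟩)]
    · have hsum := hg.2 p q
      rw [Finset.sum_filter] at hsum ⊢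
      rw [Fintype.sum_sigma]
      simp only [Fintype.sum_option, h1, h2, graftMoebius, if_false, zero_add]
      -- For `p ≤ c ≤ q`, only the unique `u` above `s` can contribute, and it lies below `t`
      -- exactly if `s` does.
      have key : ∀ c, (∑ u : τ c, if p ≤ c ∧ s.1 ≤ u.1 then if u.1 ≤ t.1 then g c q else 0 else 0)
          = if s.1 ≤ t.1 then if p ≤ c then g c q else 0 else 0 := by
        intro c
        by_cases hpc : p ≤ c
        · by_cases hcq : c ≤ q
          · obtain ⟨u, ⟨hu, hsu⟩, -⟩ := hτ p c hpc s.1 s.2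
            rw [Finset.sum_eq_single ⟨u, hu⟩]
            · have : u ≤ t.1 ↔ s.1 ≤ t.1 := by
                refine ⟨hsu.trans, fun hst => ?_⟩
                obtain ⟨t', ⟨ht', hut'⟩, -⟩ := hτ c q hcq u hu
                have := huniq (hpc.trans hcq) s.2 ht' t.2 (hsu.trans hut') hst
                exact this ▸ hut'
              simp only [hpc, hsu, and_self, if_true, this]
            · rintro ⟨v, hv⟩ - hne
              refine if_neg fun h => hne (Subtype.ext ?_)
              exact huniq hpc s.2 hv hu h.2 hsu
            · exact fun h => (h (Finset.mem_univ _)).elim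
          · simp [hg.1 c q hcq]
        · simp [hpc]
      rw [Finset.sum_congr rfl fun c _ => key c]
      by_cases hst : s.1 ≤ t.1
      · simp only [hst, if_true]
        rw [hsum]
        by_cases hpq : p = q
        · subst hpq
          have : s = t := Subtype.ext (huniq le_rfl s.2 s.2 t.2 le_rfl hst)
          simp [this]
        · rw [if_neg hpq, if_neg]
          intro h
          exact hpq (congrArg Sigma.fst h)
      · simp only [hst, if_false, Finset.sum_const_zero]
        rw [if_neg]
        intro h
        cases h
        exact hst le_rfl

open MvPolynomial in
-- Each `s` in `τ p` lies below exactly one `t` in `τ q`, so both the grafted and the mixed pairs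
-- over `p ≤ q` are counted by the cardinality of `τ p`. The mixed ones carry the sign and one more
-- factor `x`, which yields `1 - x`.
theorem sum_graftMoebius (hg : IsMoebius (· ≤ ·) g)
    (hτ : ∀ p q, p ≤ q → ∀ s ∈ τ p, ∃! t, t ∈ τ q ∧ s ≤ t)
    (n : (Σ p : A, Option (τ p)) → ℕ) (c : A → ℕ) (hn0 : ∀ p, n ⟨p, none⟩ = c p + 1)
    (hn1 : ∀ p s, n ⟨p, some s⟩ = c p) :
    (∑ x, ∑ y, C (graftMoebius g x y) * X 0 ^ n x * X 1 ^ n y : MvPolynomial (Fin 2) ℤ) =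
      X 0 * X 1 * (∑ p, ∑ q, C (g p q) * X 0 ^ c p * X 1 ^ c q) + (1 - X 0) *
        ∑ p, ∑ q, C (g p q) * ((τ p).card : MvPolynomial (Fin 2) ℤ) * X 0 ^ c p * X 1 ^ c q := by
  classical
  have hcount : ∀ p q, p ≤ q → ∀ s : τ p, (∑ t : τ q, if s.1 ≤ t.1 then (1 : ℤ) else 0) = 1 := by
    intro p q hpq s
    obtain ⟨t, ⟨ht, hst⟩, hu⟩ := hτ p q hpq s.1 s.2
    rw [Finset.sum_eq_single ⟨t, ht⟩]
    · simp [hst]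
    · rintro ⟨v, hv⟩ - hne
      exact if_neg fun h => hne (Subtype.ext (hu v ⟨hv, h⟩))
    · exact fun h => (h (Finset.mem_univ _)).elim
  rw [Finset.mul_sum, Finset.mul_sum, ← Finset.sum_add_distrib, Fintype.sum_sigma]
  refine Finset.sum_congr rfl fun p _ => ?_
  simp only [Fintype.sum_sigma]
  rw [Finset.sum_comm, Finset.mul_sum, Finset.mul_sum, ← Finset.sum_add_distrib]
  refine Finset.sum_congr rfl fun q _ => ?_
  simp only [Fintype.sum_option, graftMoebius, hn0, hn1, C_0, zero_mul, zero_add]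
  by_cases hpq : p ≤ q
  · have e1 : ∑ s : τ p, ∑ t : τ q, (C (if s.1 ≤ t.1 then g p q else 0) * X 0 ^ c p * X 1 ^ c q :
        MvPolynomial (Fin 2) ℤ) = C (g p q) * ((τ p).card : MvPolynomial (Fin 2) ℤ) *
          X 0 ^ c p * X 1 ^ c q := by
      have : ∀ s : τ p, ∑ t : τ q, (C (if s.1 ≤ t.1 then g p q else 0) * X 0 ^ c p * X 1 ^ c q :
          MvPolynomial (Fin 2) ℤ) = C (g p q) * X 0 ^ c p * X 1 ^ c q := by
        intro s
        rw [← Finset.sum_mul, ← Finset.sum_mul, ← map_sum]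
        have : (∑ t : τ q, if s.1 ≤ t.1 then g p q else 0) = g p q := by
          have := congrArg (g p q * ·) (hcount p q hpq s)
          simpa only [Finset.mul_sum, mul_ite, mul_one, mul_zero] using this
        rw [this]
      rw [Finset.sum_congr rfl fun s _ => this s, Finset.sum_const, Finset.card_univ,
        Fintype.card_coe, nsmul_eq_mul]
      ring
    have e2 : ∑ t : τ q, (C (-(g p q * ∑ s : τ p, if s.1 ≤ t.1 then 1 else 0)) * X 0 ^ (c p + 1) *
        X 1 ^ c q : MvPolynomial (Fin 2) ℤ) = - (C (g p q) *
          ((τ p).card : MvPolynomial (Fin 2) ℤ) * X 0 ^ (c p + 1) * X 1 ^ c q) := by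
      rw [← Finset.sum_mul, ← Finset.sum_mul, ← map_sum, Finset.sum_neg_distrib, ← Finset.mul_sum,
        Finset.sum_comm, Finset.sum_congr rfl fun s _ => hcount p q hpq s, Finset.sum_const,
        Finset.card_univ, Fintype.card_coe, nsmul_eq_mul, mul_one, map_neg, map_mul]
      simp
    rw [e1, e2]
    ring
  · simp [hg.1 p q hpq]

open MvPolynomial in
-- The derivative of `x ^ (c + 1)` provides the factor `c + 1`, which will be a number of trees.
theorem pderiv_X_mul_sum {P : Type*} [Fintype P] (g : P → P → ℤ) (c : P → ℕ) :
    pderiv 0 (X 0 * ∑ p, ∑ q, C (g p q) * X 0 ^ c p * X 1 ^ c q : MvPolynomial (Fin 2) ℤ) =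
      ∑ p, ∑ q, C (g p q) * ((c p + 1 : ℕ) : MvPolynomial (Fin 2) ℤ) * X 0 ^ c p * X 1 ^ c q := by
  simp only [Finset.mul_sum, map_sum]
  refine Finset.sum_congr rfl fun p _ => Finset.sum_congr rfl fun q _ => ?_
  have : (X 0 * (C (g p q) * X 0 ^ c p * X 1 ^ c q) : MvPolynomial (Fin 2) ℤ) =
      C (g p q) * (X 0 ^ (c p + 1) * X 1 ^ c q) := by ring
  rw [this, pderiv_C_mul, pderiv_mul, pderiv_pow, pderiv_pow, pderiv_X_self,
    pderiv_X_of_ne (by decide : (1 : Fin 2) ≠ 0), Nat.add_sub_cancel]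
  ring

end Graft

theorem sum_sum_mul_sum_sum {A₁ A₂ R : Type*} [Fintype A₁] [Fintype A₂] [CommSemiring R]
    (a : A₁ → A₁ → R) (b : A₂ → A₂ → R) : (∑ p, ∑ q, a p q) * (∑ p, ∑ q, b p q) =
      ∑ p : A₁ × A₂, ∑ q : A₁ × A₂, a p.1 q.1 * b p.2 q.2 := by
  simp only [Fintype.sum_prod_type, Finset.sum_mul_sum]

theorem existsUnique_product {A₁ A₂ β₁ β₂ : Type*} [PartialOrder A₁] [PartialOrder A₂]
    [PartialOrder β₁] [PartialOrder β₂] {τ₁ : A₁ → Finset β₁} {τ₂ : A₂ → Finset β₂}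
    (hτ₁ : ∀ p q, p ≤ q → ∀ s ∈ τ₁ p, ∃! t, t ∈ τ₁ q ∧ s ≤ t)
    (hτ₂ : ∀ p q, p ≤ q → ∀ s ∈ τ₂ p, ∃! t, t ∈ τ₂ q ∧ s ≤ t) (p q : A₁ × A₂) (hpq : p ≤ q)
    (s : β₁ × β₂) (hs : s ∈ τ₁ p.1 ×ˢ τ₂ p.2) : ∃! t, t ∈ τ₁ q.1 ×ˢ τ₂ q.2 ∧ s ≤ t := by
  rw [Finset.mem_product] at hs
  obtain ⟨t₁, ⟨ht₁, hst₁⟩, hu₁⟩ := hτ₁ p.1 q.1 hpq.1 s.1 hs.1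
  obtain ⟨t₂, ⟨ht₂, hst₂⟩, hu₂⟩ := hτ₂ p.2 q.2 hpq.2 s.2 hs.2
  refine ⟨(t₁, t₂), ⟨Finset.mem_product.mpr ⟨ht₁, ht₂⟩, hst₁, hst₂⟩, ?_⟩
  rintro ⟨u₁, u₂⟩ ⟨hu, hsu⟩
  rw [Finset.mem_product] at hu
  exact Prod.ext (hu₁ u₁ ⟨hu.1, hsu.1⟩) (hu₂ u₂ ⟨hu.2, hsu.2⟩)

open MvPolynomial in
-- The number of grafts over `p` is a product of two cardinalities, each a corank plus one by `hc₁`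
-- and `hc₂`. Hence the weighted sum factors into the two derivatives.
theorem mPolynomial_graft {A₁ A₂ Q β₁ β₂ : Type*} [PartialOrder A₁] [PartialOrder A₂]
    [PartialOrder Q] [PartialOrder β₁] [PartialOrder β₂] [BoundedOrder A₁] [BoundedOrder A₂]
    [BoundedOrder Q] [Finite A₁] [Finite A₂] [Finite Q] {τ₁ : A₁ → Finset β₁} {τ₂ : A₂ → Finset β₂}
    (hτ₁ : ∀ p q, p ≤ q → ∀ s ∈ τ₁ p, ∃! t, t ∈ τ₁ q ∧ s ≤ t)
    (hτ₂ : ∀ p q, p ≤ q → ∀ s ∈ τ₂ p, ∃! t, t ∈ τ₂ q ∧ s ≤ t)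
    (hc₁ : ∀ p, corank p + 1 = (τ₁ p).card) (hc₂ : ∀ p, corank p + 1 = (τ₂ p).card)
    (e : (Σ p : A₁ × A₂, Option ↥(τ₁ p.1 ×ˢ τ₂ p.2)) ≃ Q)
    (h0 : ∀ p x, e ⟨p, none⟩ ≤ e x ↔ p ≤ x.1)
    (h1 : ∀ p s q, ¬ e ⟨p, some s⟩ ≤ e ⟨q, none⟩)
    (h2 : ∀ p s q t, e ⟨p, some s⟩ ≤ e ⟨q, some t⟩ ↔ p ≤ q ∧ s.1 ≤ t.1)
    (hn0 : ∀ p, corank (e ⟨p, none⟩) = corank p.1 + corank p.2 + 1)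
    (hn1 : ∀ p s, corank (e ⟨p, some s⟩) = corank p.1 + corank p.2) :
    mPolynomial Q = X 0 * X 1 * mPolynomial A₁ * mPolynomial A₂ + (1 - X 0) *
      pderiv 0 (X 0 * mPolynomial A₁) * pderiv 0 (X 0 * mPolynomial A₂) := by
  have : Fintype A₁ := Fintype.ofFinite A₁
  have : Fintype A₂ := Fintype.ofFinite A₂
  obtain ⟨g₁, hg₁⟩ := exists_isMoebius A₁
  obtain ⟨g₂, hg₂⟩ := exists_isMoebius A₂
  have hτ := existsUnique_product hτ₁ hτ₂
  have hg := hg₁.prod hg₂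
  have e1 := mPolynomial_eq_sum (Equiv.refl A₁) hg₁
  have e2 := mPolynomial_eq_sum (Equiv.refl A₂) hg₂
  have e3 := mPolynomial_eq_sum e (isMoebius_graftMoebius hg hτ h0 h1 h2)
  have e4 := sum_graftMoebius hg hτ (fun x => corank (e x)) (fun p => corank p.1 + corank p.2)
    hn0 hn1
  rw [Equiv.coe_refl] at e1 e2
  rw [e3.trans e4, e1, e2]
  simp only [id_eq]
  rw [pderiv_X_mul_sum, pderiv_X_mul_sum, mul_assoc (X 0 * X 1),
    mul_assoc (1 - X 0), sum_sum_mul_sum_sum, sum_sum_mul_sum_sum]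
  refine congrArg₂ (· + ·) (congrArg _ ?_) (congrArg _ ?_)
  · refine Finset.sum_congr rfl fun p _ => Finset.sum_congr rfl fun q _ => ?_
    rw [C_mul]
    ring
  · refine Finset.sum_congr rfl fun p _ => Finset.sum_congr rfl fun q _ => ?_
    rw [C_mul, Finset.card_product, ← hc₁, ← hc₂, Nat.cast_mul]
    ring

/-! ### Partitions of a disjoint union with at most one mixed block -/

namespace Finpartition

variable {α : Type*} [DecidableEq α] {I₁ I₂ : Finset α}

/-- The union of partitions of two disjoint sets. -/
def disjUnion (P₁ : Finpartition I₁) (P₂ : Finpartition I₂) (hI : Disjoint I₁ I₂) :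
    Finpartition (I₁ ∪ I₂) :=
  Finpartition.ofExistsUnique (P₁.parts ∪ P₂.parts)
    (by
      intro B hB
      rcases Finset.mem_union.mp hB with h | h
      · exact (P₁.subset h).trans Finset.subset_union_left
      · exact (P₂.subset h).trans Finset.subset_union_right)
    (by
      intro i hi
      rcases Finset.mem_union.mp hi with h | h
      · obtain ⟨B, hB, hiB⟩ := P₁.exists_mem h
        refine ⟨B, ⟨Finset.mem_union_left _ hB, hiB⟩, ?_⟩
        rintro D ⟨hD, hiD⟩
        rcases Finset.mem_union.mp hD with hD | hD
        · exact P₁.eq_of_mem_parts hD hB hiD hiB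
        · exact (Finset.disjoint_left.mp hI h (P₂.subset hD hiD)).elim
      · obtain ⟨B, hB, hiB⟩ := P₂.exists_mem h
        refine ⟨B, ⟨Finset.mem_union_right _ hB, hiB⟩, ?_⟩
        rintro D ⟨hD, hiD⟩
        rcases Finset.mem_union.mp hD with hD | hD
        · exact (Finset.disjoint_left.mp hI (P₁.subset hD hiD) h).elim
        · exact P₂.eq_of_mem_parts hD hB hiD hiB)
    (fun h => (Finset.mem_union.mp h).elim P₁.empty_notMem_parts P₂.empty_notMem_parts)

variable {P₁ Q₁ : Finpartition I₁} {P₂ Q₂ : Finpartition I₂} {hI : Disjoint I₁ I₂}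
  {s₁ s₂ t₁ t₂ : Finset α}

theorem mem_disjUnion {B : Finset α} :
    B ∈ (P₁.disjUnion P₂ hI).parts ↔ B ∈ P₁.parts ∨ B ∈ P₂.parts :=
  Finset.mem_union

theorem disjUnion_mono (h₁ : P₁ ≤ Q₁) (h₂ : P₂ ≤ Q₂) :
    P₁.disjUnion P₂ hI ≤ Q₁.disjUnion Q₂ hI := by
  intro B hB
  rcases mem_disjUnion.mp hB with hB | hB
  · obtain ⟨C, hC, h⟩ := h₁ hB
    exact ⟨C, mem_disjUnion.mpr (Or.inl hC), h⟩
  · obtain ⟨C, hC, h⟩ := h₂ hB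
    exact ⟨C, mem_disjUnion.mpr (Or.inr hC), h⟩

theorem ne_of_mem_of_mem (hI : Disjoint I₁ I₂) (h₁ : s₁ ∈ P₁.parts) (h₂ : s₂ ∈ P₂.parts) :
    s₁ ≠ s₂ := by
  rintro rfl
  obtain ⟨i, hi⟩ := P₁.nonempty_of_mem_parts h₁
  exact Finset.disjoint_left.mp hI (P₁.subset h₁ hi) (P₂.subset h₂ hi)

theorem card_disjUnion :
    (P₁.disjUnion P₂ hI).parts.card = P₁.parts.card + P₂.parts.card :=
  Finset.card_union_of_disjoint
    (Finset.disjoint_left.mpr fun _ h₁ h₂ => ne_of_mem_of_mem hI h₁ h₂ rfl)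

/-- The partition obtained from `P₁ ⊔ P₂` by merging a block of `P₁` with a block of `P₂`. -/
def graft (P₁ : Finpartition I₁) (P₂ : Finpartition I₂) (hI : Disjoint I₁ I₂)
    (h₁ : s₁ ∈ P₁.parts) (h₂ : s₂ ∈ P₂.parts) : Finpartition (I₁ ∪ I₂) :=
  (P₁.disjUnion P₂ hI).merge (mem_disjUnion.mpr (Or.inl h₁)) (mem_disjUnion.mpr (Or.inr h₂))

theorem card_graft (h₁ : s₁ ∈ P₁.parts) (h₂ : s₂ ∈ P₂.parts) :
    (P₁.graft P₂ hI h₁ h₂).parts.card + 1 = P₁.parts.card + P₂.parts.card := by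
  rw [graft, card_merge _ _ (ne_of_mem_of_mem hI h₁ h₂), card_disjUnion]

/-- The mixed block imposes nothing new: a block inside `I₁` that is contained in `t₁ ∪ t₂` lies in
`t₁`, and likewise for `I₂`. -/
theorem disjUnion_le_graft_iff (h₁ : t₁ ∈ Q₁.parts) (h₂ : t₂ ∈ Q₂.parts) :
    P₁.disjUnion P₂ hI ≤ Q₁.graft Q₂ hI h₁ h₂ ↔ P₁ ≤ Q₁ ∧ P₂ ≤ Q₂ := by
  refine ⟨fun h => ⟨fun B hB => ?_, fun B hB => ?_⟩,
    fun h => (disjUnion_mono h.1 h.2).trans (le_merge _ _)⟩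
  · obtain ⟨C, hC, hBC⟩ := h (mem_disjUnion.mpr (Or.inl hB))
    obtain ⟨i, hi⟩ := P₁.nonempty_of_mem_parts hB
    have out : ∀ {j : α} {D : Finset α}, j ∈ B → D ∈ Q₂.parts → j ∉ D := fun hj hD hjD =>
      Finset.disjoint_left.mp hI (P₁.subset hB hj) (Q₂.subset hD hjD)
    rcases (mem_merge _ _).mp hC with rfl | hC
    · exact ⟨t₁, h₁, fun j hj => (Finset.mem_union.mp (hBC hj)).resolve_right (out hj h₂)⟩
    · rcases mem_disjUnion.mp hC.2.2 with hC | hC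
      · exact ⟨C, hC, hBC⟩
      · exact (out hi hC (hBC hi)).elim
  · obtain ⟨C, hC, hBC⟩ := h (mem_disjUnion.mpr (Or.inr hB))
    obtain ⟨i, hi⟩ := P₂.nonempty_of_mem_parts hB
    have out : ∀ {j : α} {D : Finset α}, j ∈ B → D ∈ Q₁.parts → j ∉ D := fun hj hD hjD =>
      Finset.disjoint_left.mp hI (Q₁.subset hD hjD) (P₂.subset hB hj)
    rcases (mem_merge _ _).mp hC with rfl | hC
    · exact ⟨t₂, h₂, fun j hj => (Finset.mem_union.mp (hBC hj)).resolve_left (out hj h₁)⟩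
    · rcases mem_disjUnion.mp hC.2.2 with hC | hC
      · exact (out hi hC (hBC hi)).elim
      · exact ⟨C, hC, hBC⟩

theorem disjUnion_le_disjUnion_iff :
    P₁.disjUnion P₂ hI ≤ Q₁.disjUnion Q₂ hI ↔ P₁ ≤ Q₁ ∧ P₂ ≤ Q₂ := by
  refine ⟨fun h => ⟨fun B hB => ?_, fun B hB => ?_⟩, fun h => disjUnion_mono h.1 h.2⟩
  · obtain ⟨C, hC, hBC⟩ := h (mem_disjUnion.mpr (Or.inl hB))
    obtain ⟨i, hi⟩ := P₁.nonempty_of_mem_parts hB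
    refine ⟨C, (mem_disjUnion.mp hC).resolve_right fun hC => ?_, hBC⟩
    exact Finset.disjoint_left.mp hI (P₁.subset hB hi) (Q₂.subset hC (hBC hi))
  · obtain ⟨C, hC, hBC⟩ := h (mem_disjUnion.mpr (Or.inr hB))
    obtain ⟨i, hi⟩ := P₂.nonempty_of_mem_parts hB
    refine ⟨C, (mem_disjUnion.mp hC).resolve_left fun hC => ?_, hBC⟩
    exact Finset.disjoint_left.mp hI (Q₁.subset hC (hBC hi)) (P₂.subset hB hi)

theorem union_not_subset_disjUnion (h₁ : s₁ ∈ P₁.parts) (h₂ : s₂ ∈ P₂.parts) {C : Finset α}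
    (hC : C ∈ (Q₁.disjUnion Q₂ hI).parts) : ¬ s₁ ∪ s₂ ⊆ C := by
  intro h
  obtain ⟨i, hi⟩ := P₁.nonempty_of_mem_parts h₁
  obtain ⟨j, hj⟩ := P₂.nonempty_of_mem_parts h₂
  rcases mem_disjUnion.mp hC with hC | hC
  · exact Finset.disjoint_left.mp hI (Q₁.subset hC (h (Finset.mem_union_right _ hj)))
      (P₂.subset h₂ hj)
  · exact Finset.disjoint_left.mp hI (P₁.subset h₁ hi)
      (Q₂.subset hC (h (Finset.mem_union_left _ hi)))

theorem not_graft_le_disjUnion (h₁ : s₁ ∈ P₁.parts) (h₂ : s₂ ∈ P₂.parts) :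
    ¬ P₁.graft P₂ hI h₁ h₂ ≤ Q₁.disjUnion Q₂ hI := by
  intro h
  obtain ⟨C, hC, hs⟩ := h ((mem_merge _ _).mpr (Or.inl rfl))
  exact union_not_subset_disjUnion h₁ h₂ hC hs

theorem graft_le_graft_iff (h₁ : s₁ ∈ P₁.parts) (h₂ : s₂ ∈ P₂.parts) (k₁ : t₁ ∈ Q₁.parts)
    (k₂ : t₂ ∈ Q₂.parts) :
    P₁.graft P₂ hI h₁ h₂ ≤ Q₁.graft Q₂ hI k₁ k₂ ↔ (P₁ ≤ Q₁ ∧ P₂ ≤ Q₂) ∧ s₁ ⊆ t₁ ∧ s₂ ⊆ t₂ := by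
  constructor
  · intro h
    refine ⟨(disjUnion_le_graft_iff k₁ k₂).mp ((le_merge _ _).trans h), ?_⟩
    obtain ⟨C, hC, hs⟩ := h ((mem_merge _ _).mpr (Or.inl rfl))
    rcases (mem_merge _ _).mp hC with rfl | hC
    · refine ⟨fun i hi => ?_, fun i hi => ?_⟩
      · exact (Finset.mem_union.mp (hs (Finset.mem_union_left _ hi))).resolve_right fun h =>
          Finset.disjoint_left.mp hI (P₁.subset h₁ hi) (Q₂.subset k₂ h)
      · exact (Finset.mem_union.mp (hs (Finset.mem_union_right _ hi))).resolve_left fun h =>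
          Finset.disjoint_left.mp hI (Q₁.subset k₁ h) (P₂.subset h₂ hi)
    · exact (union_not_subset_disjUnion h₁ h₂ hC.2.2 hs).elim
  · rintro ⟨h, hs₁, hs₂⟩
    exact merge_le ((disjUnion_le_graft_iff k₁ k₂).mpr h) ((mem_merge _ _).mpr (Or.inl rfl)) _ _
      (Finset.Subset.trans hs₁ Finset.subset_union_left)
      (Finset.Subset.trans hs₂ Finset.subset_union_right)

theorem mem_restrict {I J : Finset α} {P : Finpartition I} {hJ : J ≤ I} {B : Finset α} :
    B ∈ (P.restrict hJ).parts ↔ B.Nonempty ∧ ∃ C ∈ P.parts, C ∩ J = B := by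
  simp [Finpartition.restrict, Finset.nonempty_iff_ne_empty]

variable {Q : Finpartition (I₁ ∪ I₂)}

theorem disjUnion_restrict_le : (Q.restrict (b := I₁) Finset.subset_union_left).disjUnion
    (Q.restrict (b := I₂) Finset.subset_union_right) hI ≤ Q := by
  intro B hB
  rcases mem_disjUnion.mp hB with hB | hB
  all_goals
    obtain ⟨-, C, hC, rfl⟩ := mem_restrict.mp hB
    exact ⟨C, hC, Finset.inter_subset_left⟩

theorem mem_disjUnion_restrict {B : Finset α} (hB : B ∈ Q.parts)
    (h : ¬ ((B ∩ I₁).Nonempty ∧ (B ∩ I₂).Nonempty)) :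
    B ∈ ((Q.restrict (b := I₁) Finset.subset_union_left).disjUnion
      (Q.restrict (b := I₂) Finset.subset_union_right) hI).parts := by
  have hB' := Finset.inter_eq_left.mpr (Q.subset hB)
  rw [Finset.inter_union_distrib_left] at hB'
  have hn := Q.nonempty_of_mem_parts hB
  rw [mem_disjUnion, mem_restrict, mem_restrict]
  by_cases h1 : (B ∩ I₁).Nonempty
  · have h2 : B ∩ I₂ = ∅ := Finset.not_nonempty_iff_eq_empty.mp fun h2 => h ⟨h1, h2⟩
    rw [h2, Finset.union_empty] at hB'
    exact Or.inl ⟨hn, B, hB, hB'⟩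
  · rw [Finset.not_nonempty_iff_eq_empty.mp h1, Finset.empty_union] at hB'
    exact Or.inr ⟨hn, B, hB, hB'⟩

/-- The hypothesis `hQ` is admissibility at the lowest vertex of `T₁ ∨ T₂`. The two cases are
whether a block meets both sides; if so, its traces are the blocks to be merged. -/
theorem exists_eq_disjUnion_or_graft (hI : Disjoint I₁ I₂)
    (hQ : ∀ B ∈ Q.parts, ∀ B' ∈ Q.parts, (B ∩ I₁).Nonempty → (B ∩ I₂).Nonempty →
      (B' ∩ I₁).Nonempty → (B' ∩ I₂).Nonempty → B = B') :
    Q = (Q.restrict (b := I₁) Finset.subset_union_left).disjUnion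
      (Q.restrict (b := I₂) Finset.subset_union_right) hI ∨
    ∃ s₁ s₂, ∃ (h₁ : s₁ ∈ (Q.restrict (b := I₁) Finset.subset_union_left).parts)
      (h₂ : s₂ ∈ (Q.restrict (b := I₂) Finset.subset_union_right).parts),
      Q = (Q.restrict (b := I₁) Finset.subset_union_left).graft
        (Q.restrict (b := I₂) Finset.subset_union_right) hI h₁ h₂ := by
  by_cases h : ∃ C ∈ Q.parts, (C ∩ I₁).Nonempty ∧ (C ∩ I₂).Nonempty
  · obtain ⟨C, hC, hC₁, hC₂⟩ := h
    refine Or.inr ⟨C ∩ I₁, C ∩ I₂, mem_restrict.mpr ⟨hC₁, C, hC, rfl⟩,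
      mem_restrict.mpr ⟨hC₂, C, hC, rfl⟩, le_antisymm ?_ ?_⟩
    · intro B hB
      by_cases hBC : B = C
      · subst hBC
        refine ⟨_, (mem_merge _ _).mpr (Or.inl rfl), ?_⟩
        rw [← Finset.inter_union_distrib_left]
        exact Finset.subset_inter le_rfl (Q.subset hB)
      · exact le_merge _ _ (mem_disjUnion_restrict hB
          fun h => hBC (hQ B hB C hC h.1 h.2 hC₁ hC₂))
    · exact merge_le disjUnion_restrict_le hC _ _ Finset.inter_subset_left
        Finset.inter_subset_left
  · refine Or.inl (le_antisymm (fun B hB => ?_) disjUnion_restrict_le)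
    exact ⟨B, mem_disjUnion_restrict hB fun h' => h ⟨B, hB, h'⟩, le_rfl⟩

theorem existsUnique_part {I : Finset α} {P R : Finpartition I} (h : P ≤ R) {s : Finset α}
    (hs : s ∈ P.parts) : ∃! t, t ∈ R.parts ∧ s ≤ t := by
  obtain ⟨t, ht, hst⟩ := h hs
  obtain ⟨i, hi⟩ := P.nonempty_of_mem_parts hs
  exact ⟨t, ⟨ht, hst⟩, fun u hu => R.eq_of_mem_parts hu.1 ht (hu.2 hi) (hst hi)⟩

end Finpartition

/-! ### The interval below `T₁ ∨ T₂` -/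

namespace Forest

variable {α : Type*} [DecidableEq α] {I₁ I₂ : Finset α} {T₁ : Forest I₁} {T₂ : Forest I₂}
  {hT₁ : T₁.IsTree} {hT₂ : T₂.IsTree} {hI : Disjoint I₁ I₂}

theorem mem_vee {s : Finset α} : s ∈ (vee T₁ T₂ hT₁ hT₂ hI).clusters ↔
    s = I₁ ∪ I₂ ∨ s ∈ T₁.clusters ∨ s ∈ T₂.clusters := by
  change s ∈ insert (I₁ ∪ I₂) (T₁.clusters ∪ T₂.clusters) ↔ _
  rw [Finset.mem_insert, Finset.mem_union]

theorem isTree_vee : (vee T₁ T₂ hT₁ hT₂ hI).IsTree := mem_vee.mpr (Or.inl rfl)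

/-- No block meets both `I₁` and `I₂`, so the lowest vertex is not split, and a split at any other
vertex takes place within `T₁` or within `T₂`. -/
theorem Admissible.disjUnion {P₁ : Finpartition I₁} {P₂ : Finpartition I₂}
    (h₁ : T₁.Admissible P₁) (h₂ : T₂.Admissible P₂) :
    (vee T₁ T₂ hT₁ hT₂ hI).Admissible (P₁.disjUnion P₂ hI) := by
  intro a ha b hb hab hu B hB B' hB' hBa hBb hBa' hBb'
  have out : ∀ {i : α}, i ∈ I₁ → i ∈ I₂ → False := fun h h' => Finset.disjoint_left.mp hI h h'
  -- A vertex with a disjoint sibling is not the lowest one.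
  have hne : ∀ {a b : Finset α}, Disjoint a b → b ∈ (vee T₁ T₂ hT₁ hT₂ hI).clusters →
      a ∈ (vee T₁ T₂ hT₁ hT₂ hI).clusters → a ∈ T₁.clusters ∨ a ∈ T₂.clusters := by
    intro a b hab hb ha
    refine (mem_vee.mp ha).resolve_left ?_
    rintro rfl
    obtain ⟨i, hi⟩ := Forest.nonempty _ b hb
    exact Finset.disjoint_left.mp hab (Forest.subset _ b hb hi) hi
  obtain ⟨i, hi⟩ := hBa
  obtain ⟨j, hj⟩ := hBb
  obtain ⟨i', hi'⟩ := hBa'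
  obtain ⟨j', hj'⟩ := hBb'
  have mBa := hi
  have mBb := hj
  have mBa' := hi'
  have mBb' := hj'
  rw [Finset.mem_inter] at hi hj hi' hj'
  have in1 : ∀ {B : Finset α} {x : α}, B ∈ (P₁.disjUnion P₂ hI).parts → x ∈ B → x ∈ I₁ →
      B ∈ P₁.parts := fun hB hx hx' => (Finpartition.mem_disjUnion.mp hB).resolve_right
        fun h => out hx' (P₂.subset h hx)
  have in2 : ∀ {B : Finset α} {x : α}, B ∈ (P₁.disjUnion P₂ hI).parts → x ∈ B → x ∈ I₂ →
      B ∈ P₂.parts := fun hB hx hx' => (Finpartition.mem_disjUnion.mp hB).resolve_left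
        fun h => out (P₁.subset h hx) hx'
  rcases hne hab hb ha with ha | ha <;> rcases hne hab.symm (by assumption) hb with hb | hb
  · have hia := T₁.subset a ha hi.2
    have hia' := T₁.subset a ha hi'.2
    refine h₁ a ha b hb hab ?_ B (in1 hB hi.1 hia) B' (in1 hB' hi'.1 hia')
      ⟨i, mBa⟩ ⟨j, mBb⟩ ⟨i', mBa'⟩ ⟨j', mBb'⟩
    have hs := Finset.union_subset (T₁.subset a ha) (T₁.subset b hb)
    rcases mem_vee.mp hu with h | h | h
    · obtain ⟨k, hk⟩ := T₂.nonempty _ hT₂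
      exact (out (hs (h ▸ Finset.mem_union_right _ hk)) hk).elim
    · exact h
    · exact (out hia (T₂.subset _ h (Finset.mem_union_left _ hi.2))).elim
  · exact (out (P₁.subset (in1 hB hi.1 (T₁.subset a ha hi.2)) hj.1) (T₂.subset b hb hj.2)).elim
  · exact (out (P₁.subset (in1 hB hj.1 (T₁.subset b hb hj.2)) hi.1) (T₂.subset a ha hi.2)).elim
  · have hia := T₂.subset a ha hi.2
    have hia' := T₂.subset a ha hi'.2
    refine h₂ a ha b hb hab ?_ B (in2 hB hi.1 hia) B' (in2 hB' hi'.1 hia')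
      ⟨i, mBa⟩ ⟨j, mBb⟩ ⟨i', mBa'⟩ ⟨j', mBb'⟩
    have hs := Finset.union_subset (T₂.subset a ha) (T₂.subset b hb)
    rcases mem_vee.mp hu with h | h | h
    · obtain ⟨k, hk⟩ := T₁.nonempty _ hT₁
      exact (out hk (hs (h ▸ Finset.mem_union_left _ hk))).elim
    · exact (out (T₁.subset _ h (Finset.mem_union_left _ hi.2)) hia).elim
    · exact h

/-- No block of the disjoint union splits the lowest vertex, so `Admissible.merge` applies there. -/
theorem Admissible.graft {P₁ : Finpartition I₁} {P₂ : Finpartition I₂} {s₁ s₂ : Finset α}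
    (h₁ : T₁.Admissible P₁) (h₂ : T₂.Admissible P₂) (hs₁ : s₁ ∈ P₁.parts) (hs₂ : s₂ ∈ P₂.parts) :
    (vee T₁ T₂ hT₁ hT₂ hI).Admissible (P₁.graft P₂ hI hs₁ hs₂) := by
  refine (Admissible.disjUnion h₁ h₂).merge isTree_vee (mem_vee.mpr (Or.inr (Or.inl hT₁)))
    (mem_vee.mpr (Or.inr (Or.inr hT₂))) hI isTree_vee ?_ _ _ ?_ ?_
  · rintro D hD ⟨⟨i, hi⟩, ⟨j, hj⟩⟩
    rw [Finset.mem_inter] at hi hj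
    rcases Finpartition.mem_disjUnion.mp hD with hD | hD
    · exact Finset.disjoint_left.mp hI (P₁.subset hD hj.1) hj.2
    · exact Finset.disjoint_left.mp hI hi.2 (P₂.subset hD hi.1)
  · rw [Finset.inter_eq_left.mpr (P₁.subset hs₁)]
    exact P₁.nonempty_of_mem_parts hs₁
  · rw [Finset.inter_eq_left.mpr (P₂.subset hs₂)]
    exact P₂.nonempty_of_mem_parts hs₂

theorem Admissible.restrict {I J : Finset α} {T : Forest I} {S : Forest J} {P : Finpartition I}
    (h : T.Admissible P) (hJ : J ≤ I) (hS : S.clusters ⊆ T.clusters) :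
    S.Admissible (P.restrict hJ) := by
  intro a ha b hb hab hu B hB B' hB' hBa hBb hBa' hBb'
  obtain ⟨-, C, hC, rfl⟩ := Finpartition.mem_restrict.mp hB
  obtain ⟨-, C', hC', rfl⟩ := Finpartition.mem_restrict.mp hB'
  have hmono : ∀ {C a : Finset α}, (C ∩ J ∩ a).Nonempty → (C ∩ a).Nonempty :=
    fun h => h.mono (Finset.inter_subset_inter_right Finset.inter_subset_left)
  rw [h a (hS ha) b (hS hb) hab (hS hu) C hC C' hC' (hmono hBa) (hmono hBb) (hmono hBa')
    (hmono hBb')]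

theorem roots_disjUnion (F₁ : Forest I₁) (F₂ : Forest I₂) (hI : Disjoint I₁ I₂) :
    (disjUnion F₁ F₂ hI).roots = F₁.roots.disjUnion F₂.roots hI := by
  refine le_antisymm (fun B hB => ?_) (fun B hB => ?_)
  · rcases Finset.mem_union.mp (mem_roots.mp hB).1 with h | h
    · obtain ⟨r, hr, hBr⟩ := exists_root h
      exact ⟨r, Finpartition.mem_disjUnion.mpr (Or.inl hr), hBr⟩
    · obtain ⟨r, hr, hBr⟩ := exists_root h
      exact ⟨r, Finpartition.mem_disjUnion.mpr (Or.inr hr), hBr⟩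
  · rcases Finpartition.mem_disjUnion.mp hB with h | h
    · exact exists_root (Finset.mem_union_left _ (mem_roots.mp h).1)
    · exact exists_root (Finset.mem_union_right _ (mem_roots.mp h).1)

variable {F₁ : Forest I₁} {F₂ : Forest I₂}

/-- The partition of the labels for a pair of forests and a choice of trees to be grafted. -/
def graftPartition (hI : Disjoint I₁ I₂) :
    (Σ p : Set.Icc F₁ T₁ × Set.Icc F₂ T₂, Option ↥(p.1.1.roots.parts ×ˢ p.2.1.roots.parts)) →
      Finpartition (I₁ ∪ I₂)
  | ⟨p, none⟩ => p.1.1.roots.disjUnion p.2.1.roots hI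
  | ⟨p, some s⟩ => p.1.1.roots.graft p.2.1.roots hI (Finset.mem_product.mp s.2).1
      (Finset.mem_product.mp s.2).2

theorem roots_le_roots_iff {F T : Forest I₁} (hT : T.IsTree) (p q : Set.Icc F T) :
    p.1.roots ≤ q.1.roots ↔ p ≤ q :=
  (iccEquiv hT (p.2.1.trans p.2.2)).le_iff_le (x := p) (y := q)

theorem graftPartition_none_le (hT₁ : T₁.IsTree) (hT₂ : T₂.IsTree)
    (p : Set.Icc F₁ T₁ × Set.Icc F₂ T₂) (x) :
    graftPartition hI ⟨p, none⟩ ≤ graftPartition hI x ↔ p ≤ x.1 := by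
  obtain ⟨q, _ | t⟩ := x
  · rw [Prod.le_def, ← roots_le_roots_iff hT₁, ← roots_le_roots_iff hT₂]
    exact Finpartition.disjUnion_le_disjUnion_iff (hI := hI)
  · have ht := Finset.mem_product.mp t.2
    rw [Prod.le_def, ← roots_le_roots_iff hT₁, ← roots_le_roots_iff hT₂]
    exact Finpartition.disjUnion_le_graft_iff ht.1 ht.2

theorem graftPartition_some_le (hT₁ : T₁.IsTree) (hT₂ : T₂.IsTree)
    (p q : Set.Icc F₁ T₁ × Set.Icc F₂ T₂) (s t) :
    graftPartition hI ⟨p, some s⟩ ≤ graftPartition hI ⟨q, some t⟩ ↔ p ≤ q ∧ s.1 ≤ t.1 := by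
  rw [Prod.le_def, Prod.le_def, ← roots_le_roots_iff hT₁, ← roots_le_roots_iff hT₂]
  have hs := Finset.mem_product.mp s.2
  have ht := Finset.mem_product.mp t.2
  exact Finpartition.graft_le_graft_iff hs.1 hs.2 ht.1 ht.2

theorem graftPartition_injective (hT₁ : T₁.IsTree) (hT₂ : T₂.IsTree) :
    Function.Injective (graftPartition (F₁ := F₁) (F₂ := F₂) (T₁ := T₁) (T₂ := T₂) hI) := by
  rintro ⟨p, _ | s⟩ ⟨q, _ | t⟩ h
  · have : p = q := le_antisymm ((graftPartition_none_le hT₁ hT₂ p _).mp h.le)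
      ((graftPartition_none_le hT₁ hT₂ q _).mp h.ge)
    rw [this]
  · have ht := Finset.mem_product.mp t.2
    exact (Finpartition.not_graft_le_disjUnion ht.1 ht.2 h.ge).elim
  · have hs := Finset.mem_product.mp s.2
    exact (Finpartition.not_graft_le_disjUnion hs.1 hs.2 h.le).elim
  · obtain ⟨h1, h2⟩ := (graftPartition_some_le hT₁ hT₂ p q s t).mp h.le
    obtain ⟨h3, h4⟩ := (graftPartition_some_le hT₁ hT₂ q p t s).mp h.ge
    obtain rfl := le_antisymm h1 h3
    rw [show s = t from Subtype.ext (le_antisymm h2 h4)]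

theorem graftPartition_mem (x : Σ p : Set.Icc F₁ T₁ × Set.Icc F₂ T₂,
      Option ↥(p.1.1.roots.parts ×ˢ p.2.1.roots.parts)) :
    (vee T₁ T₂ hT₁ hT₂ hI).Admissible (graftPartition hI x) ∧
      (disjUnion F₁ F₂ hI).roots ≤ graftPartition hI x := by
  rw [roots_disjUnion]
  obtain ⟨p, _ | s⟩ := x
  · exact ⟨Admissible.disjUnion (admissible_roots p.1.2.2) (admissible_roots p.2.2.2),
      Finpartition.disjUnion_mono (roots_mono p.1.2.1) (roots_mono p.2.2.1)⟩
  · have hs := Finset.mem_product.mp s.2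
    exact ⟨Admissible.graft (admissible_roots p.1.2.2) (admissible_roots p.2.2.2) hs.1 hs.2,
      (Finpartition.disjUnion_le_graft_iff hs.1 hs.2).mpr
        ⟨roots_mono p.1.2.1, roots_mono p.2.2.1⟩⟩

/-- The traces of `Q` on `I₁` and `I₂` are admissible, so `iccEquiv` turns them into forests below
`T₁` and `T₂`; all that `Q` adds is the possible mixed block. -/
theorem exists_graftPartition_eq (h₁ : F₁ ≤ T₁) (h₂ : F₂ ≤ T₂) {Q : Finpartition (I₁ ∪ I₂)}
    (hQ : (vee T₁ T₂ hT₁ hT₂ hI).Admissible Q) (hFQ : (disjUnion F₁ F₂ hI).roots ≤ Q) :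
    ∃ x, graftPartition (F₁ := F₁) (F₂ := F₂) (T₁ := T₁) (T₂ := T₂) hI x = Q := by
  have c₁ : T₁.clusters ⊆ (vee T₁ T₂ hT₁ hT₂ hI).clusters := fun s hs => mem_vee.mpr (by simp [hs])
  have c₂ : T₂.clusters ⊆ (vee T₁ T₂ hT₁ hT₂ hI).clusters := fun s hs => mem_vee.mpr (by simp [hs])
  rw [roots_disjUnion] at hFQ
  have key : ∀ (Q₁ : Finpartition I₁) (Q₂ : Finpartition I₂), T₁.Admissible Q₁ →
      T₂.Admissible Q₂ → F₁.roots ≤ Q₁ → F₂.roots ≤ Q₂ →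
      ∃ p : Set.Icc F₁ T₁ × Set.Icc F₂ T₂, p.1.1.roots = Q₁ ∧ p.2.1.roots = Q₂ :=
    fun Q₁ Q₂ hQ₁ hQ₂ hF₁ hF₂ => ⟨((iccEquiv hT₁ h₁).symm ⟨Q₁, hQ₁, hF₁⟩,
      (iccEquiv hT₂ h₂).symm ⟨Q₂, hQ₂, hF₂⟩), roots_restrict hT₁ Q₁, roots_restrict hT₂ Q₂⟩
  have hQ₁ := hQ.restrict (J := I₁) Finset.subset_union_left c₁
  have hQ₂ := hQ.restrict (J := I₂) Finset.subset_union_right c₂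
  rcases Finpartition.exists_eq_disjUnion_or_graft hI (hQ I₁ (c₁ hT₁) I₂ (c₂ hT₂) hI isTree_vee)
    with h | ⟨s₁, s₂, hs₁, hs₂, h⟩
  · have hle := hFQ
    rw [h, Finpartition.disjUnion_le_disjUnion_iff] at hle
    obtain ⟨p, hp₁, hp₂⟩ := key _ _ hQ₁ hQ₂ hle.1 hle.2
    refine ⟨⟨p, none⟩, ?_⟩
    rw [graftPartition, hp₁, hp₂, ← h]
  · have hle := hFQ
    rw [h, Finpartition.disjUnion_le_graft_iff] at hle
    obtain ⟨p, hp₁, hp₂⟩ := key _ _ hQ₁ hQ₂ hle.1 hle.2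
    refine ⟨⟨p, some ⟨(s₁, s₂), ?_⟩⟩, ?_⟩
    · rw [hp₁, hp₂]
      exact Finset.mem_product.mpr ⟨hs₁, hs₂⟩
    · simp only [graftPartition, hp₁, hp₂]
      exact h.symm

/-- The interval below `T₁ ∨ T₂` in terms of the intervals below `T₁` and `T₂`. -/
noncomputable def graftEquiv (hT₁ : T₁.IsTree) (hT₂ : T₂.IsTree) (hI : Disjoint I₁ I₂)
    (h₁ : F₁ ≤ T₁) (h₂ : F₂ ≤ T₂) (h : disjUnion F₁ F₂ hI ≤ vee T₁ T₂ hT₁ hT₂ hI) :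
    (Σ p : Set.Icc F₁ T₁ × Set.Icc F₂ T₂, Option ↥(p.1.1.roots.parts ×ˢ p.2.1.roots.parts)) ≃
      Set.Icc (disjUnion F₁ F₂ hI) (vee T₁ T₂ hT₁ hT₂ hI) :=
  (Equiv.ofBijective (fun x => ⟨graftPartition hI x, graftPartition_mem x⟩)
    ⟨fun _ _ h => graftPartition_injective hT₁ hT₂ (congrArg Subtype.val h),
      fun Q => (exists_graftPartition_eq h₁ h₂ Q.2.1 Q.2.2).imp fun _ h => Subtype.ext h⟩).trans
    (iccEquiv isTree_vee h).symm.toEquiv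

theorem roots_graftEquiv (h₁ : F₁ ≤ T₁) (h₂ : F₂ ≤ T₂)
    (h : disjUnion F₁ F₂ hI ≤ vee T₁ T₂ hT₁ hT₂ hI) (x) :
    (graftEquiv hT₁ hT₂ hI h₁ h₂ h x).1.roots = graftPartition hI x :=
  roots_restrict isTree_vee _

theorem intervalM_vee (h₁ : F₁ ≤ T₁) (h₂ : F₂ ≤ T₂)
    (h : disjUnion F₁ F₂ hI ≤ vee T₁ T₂ hT₁ hT₂ hI) :
    intervalM h = MvPolynomial.X 0 * MvPolynomial.X 1 * intervalM h₁ * intervalM h₂ +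
      (1 - MvPolynomial.X 0) * MvPolynomial.pderiv 0 (MvPolynomial.X 0 * intervalM h₁) *
        MvPolynomial.pderiv 0 (MvPolynomial.X 0 * intervalM h₂) := by
  have f : Fact (disjUnion F₁ F₂ hI ≤ vee T₁ T₂ hT₁ hT₂ hI) := ⟨h⟩
  have f₁ : Fact (F₁ ≤ T₁) := ⟨h₁⟩
  have f₂ : Fact (F₂ ≤ T₂) := ⟨h₂⟩
  have hle : ∀ x y, graftEquiv hT₁ hT₂ hI h₁ h₂ h x ≤ graftEquiv hT₁ hT₂ hI h₁ h₂ h y ↔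
      graftPartition hI x ≤ graftPartition hI y := by
    intro x y
    rw [← roots_le_roots_iff isTree_vee, roots_graftEquiv, roots_graftEquiv]
  refine mPolynomial_graft (A₁ := Set.Icc F₁ T₁) (A₂ := Set.Icc F₂ T₂)
    (τ₁ := fun p => p.1.roots.parts) (τ₂ := fun p => p.1.roots.parts)
    (fun p q hpq s hs => Finpartition.existsUnique_part (roots_mono hpq) hs)
    (fun p q hpq s hs => Finpartition.existsUnique_part (roots_mono hpq) hs)
    (corank_add_one hT₁) (corank_add_one hT₂) (graftEquiv hT₁ hT₂ hI h₁ h₂ h) ?_ ?_ ?_ ?_ ?_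
  · intro p x
    rw [hle, graftPartition_none_le hT₁ hT₂]
  · intro p s q
    have hs := Finset.mem_product.mp s.2
    rw [hle]
    exact Finpartition.not_graft_le_disjUnion hs.1 hs.2
  · intro p s q t
    rw [hle, graftPartition_some_le hT₁ hT₂]
  -- Coranks are numbers of trees minus one: the numbers of trees add up, so the coranks add up to
  -- one less. A graft costs one tree and removes this excess.
  · intro p
    have e := corank_add_one isTree_vee (graftEquiv hT₁ hT₂ hI h₁ h₂ h ⟨p, none⟩)
    rw [roots_graftEquiv, graftPartition, Finpartition.card_disjUnion,
      ← corank_add_one hT₁, ← corank_add_one hT₂] at e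
    omega
  · intro p s
    have e := corank_add_one isTree_vee (graftEquiv hT₁ hT₂ hI h₁ h₂ h ⟨p, some s⟩)
    have e' := Finpartition.card_graft (hI := hI) (Finset.mem_product.mp s.2).1
      (Finset.mem_product.mp s.2).2
    rw [← corank_add_one hT₁, ← corank_add_one hT₂] at e'
    rw [roots_graftEquiv, graftPartition] at e
    omega

/-- The part of a forest with labels in a subset. -/
def part {I : Finset α} (F : Forest I) (J : Finset α) (hJ : J ⊆ I) : Forest J where
  clusters := F.clusters.filter (· ⊆ J)
  subset := fun _ hs => (Finset.mem_filter.mp hs).2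
  nonempty := fun s hs => F.nonempty s (Finset.mem_filter.mp hs).1
  leaf := fun i hi => Finset.mem_filter.mpr ⟨F.leaf i (hJ hi), Finset.singleton_subset_iff.mpr hi⟩
  laminar := fun s hs t ht => F.laminar s (Finset.mem_filter.mp hs).1 t (Finset.mem_filter.mp ht).1
  binary := by
    intro s hs hc
    rw [Finset.mem_filter] at hs
    obtain ⟨a, ha, b, hb, hab, rfl⟩ := F.binary s hs.1 hc
    exact ⟨a, Finset.mem_filter.mpr ⟨ha, Finset.subset_union_left.trans hs.2⟩,
      b, Finset.mem_filter.mpr ⟨hb, Finset.subset_union_right.trans hs.2⟩, hab, rfl⟩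

/-- By `hS` the clusters of `S` are those of `T` inside `J`, so a hull in `S` is a hull in `T` and
injectivity is inherited. The condition `hF` ensures that hulls in `S` exist. -/
theorem part_le {I J : Finset α} {F T : Forest I} {S : Forest J} (h : F ≤ T) (hJ : J ⊆ I)
    (hS : ∀ w, w ∈ S.clusters ↔ w ∈ T.clusters ∧ w ⊆ J)
    (hF : ∀ s ∈ F.clusters, s ⊆ J → ∃ w ∈ T.clusters, s ⊆ w ∧ w ⊆ J) : F.part J hJ ≤ S := by
  obtain ⟨-, h2, h3⟩ := le_iff.mp h
  refine le_iff.mpr ⟨fun s hs => ?_, fun r hr w hw hn => ?_, ?_⟩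
  · rw [part, Finset.mem_filter] at hs
    obtain ⟨w, hw, hsw, hwJ⟩ := hF s hs.1 hs.2
    exact ⟨w, (hS w).mpr ⟨hw, hwJ⟩, hsw⟩
  · rw [part, Finset.mem_filter] at hr ⊢
    exact ⟨h2 r hr.1 w ((hS w).mp hw).1 hn, Finset.inter_subset_left.trans hr.2⟩
  · have key : ∀ {s w : Finset α}, s ∈ F.clusters → IsHull S.clusters s w →
        IsHull T.clusters s w := by
      intro s w hs hsw
      obtain ⟨hwT, hwJ⟩ := (hS w).mp hsw.1
      refine ⟨hwT, hsw.2.1, fun w' hw' hsw' => ?_⟩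
      obtain ⟨i, hi⟩ := F.nonempty s hs
      rcases T.comparable hwT hw' (hsw.2.1 hi) (hsw' hi) with h | h
      · exact h
      · exact hsw.2.2 w' ((hS w').mpr ⟨hw', Finset.Subset.trans h hwJ⟩) hsw'
    intro s hs t ht w hcs hct hsw htw
    rw [part, Finset.mem_filter] at hs ht
    exact h3 s hs.1 t ht.1 w hcs hct (key hs.1 hsw) (key ht.1 htw)

end Forest

/-! ### Decomposition of `F` and the formula -/

theorem mainTheorem2 {α : Type*} [DecidableEq α] {I₁ I₂ : Finset α} (hI : Disjoint I₁ I₂)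
    (T₁ : Forest I₁) (T₂ : Forest I₂) (hT₁ : T₁.IsTree) (hT₂ : T₂.IsTree)
    (F : Forest (I₁ ∪ I₂)) (f : Forest.Map F (Forest.vee T₁ T₂ hT₁ hT₂ hI))
    (hf : ∀ v : F.Vertex, v.IsInner → (f.toFun v).1 ≠ I₁ ∪ I₂) :
    ∃ (F₁ : Forest I₁) (F₂ : Forest I₂) (h₁ : F₁ ≤ T₁) (h₂ : F₂ ≤ T₂)
      (h : F ≤ Forest.vee T₁ T₂ hT₁ hT₂ hI), F = Forest.disjUnion F₁ F₂ hI ∧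
      Forest.intervalM h =
        MvPolynomial.X 0 * MvPolynomial.X 1 * Forest.intervalM h₁ * Forest.intervalM h₂ +
          (1 - MvPolynomial.X 0) *
            MvPolynomial.pderiv 0 (MvPolynomial.X 0 * Forest.intervalM h₁) *
            MvPolynomial.pderiv 0 (MvPolynomial.X 0 * Forest.intervalM h₂) := by
  have h : F ≤ Forest.vee T₁ T₂ hT₁ hT₂ hI := ⟨f⟩
  have out : ∀ {i : α}, i ∈ I₁ → i ∈ I₂ → False := fun h h' => Finset.disjoint_left.mp hI h h'
  have hF : ∀ s ∈ F.clusters, ∃ w, s ⊆ w ∧ (w ∈ T₁.clusters ∨ w ∈ T₂.clusters) := by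
    intro s hs
    by_cases hc : 1 < s.card
    · refine ⟨(f.toFun ⟨s, hs⟩).1, f.subset_toFun ⟨s, hs⟩, ?_⟩
      exact (Forest.mem_vee.mp (f.toFun ⟨s, hs⟩).2).resolve_left (hf ⟨s, hs⟩ hc)
    · obtain ⟨i, hi, rfl⟩ := F.not_inner_eq hs hc
      exact ⟨{i}, Finset.Subset.refl _, (Finset.mem_union.mp hi).imp (T₁.leaf i) (T₂.leaf i)⟩
  have h₁ : F.part I₁ Finset.subset_union_left ≤ T₁ := by
    refine Forest.part_le h _ (fun w => ⟨fun hw => ?_, fun hw => ?_⟩) (fun s hs hsI => ?_)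
    · exact ⟨Forest.mem_vee.mpr (Or.inr (Or.inl hw)), T₁.subset w hw⟩
    · rcases Forest.mem_vee.mp hw.1 with rfl | h | h
      · obtain ⟨i, hi⟩ := T₂.nonempty _ hT₂
        exact (out (hw.2 (Finset.mem_union_right _ hi)) hi).elim
      · exact h
      · obtain ⟨i, hi⟩ := T₂.nonempty _ h
        exact (out (hw.2 hi) (T₂.subset _ h hi)).elim
    · obtain ⟨w, hsw, hw | hw⟩ := hF s hs
      · exact ⟨w, Forest.mem_vee.mpr (Or.inr (Or.inl hw)), hsw, T₁.subset w hw⟩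
      · obtain ⟨i, hi⟩ := F.nonempty s hs
        exact (out (hsI hi) (T₂.subset w hw (hsw hi))).elim
  have h₂ : F.part I₂ Finset.subset_union_right ≤ T₂ := by
    refine Forest.part_le h _ (fun w => ⟨fun hw => ?_, fun hw => ?_⟩) (fun s hs hsI => ?_)
    · exact ⟨Forest.mem_vee.mpr (Or.inr (Or.inr hw)), T₂.subset w hw⟩
    · rcases Forest.mem_vee.mp hw.1 with rfl | h | h
      · obtain ⟨i, hi⟩ := T₁.nonempty _ hT₁
        exact (out hi (hw.2 (Finset.mem_union_left _ hi))).elim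
      · obtain ⟨i, hi⟩ := T₁.nonempty _ h
        exact (out (T₁.subset _ h hi) (hw.2 hi)).elim
      · exact h
    · obtain ⟨w, hsw, hw | hw⟩ := hF s hs
      · obtain ⟨i, hi⟩ := F.nonempty s hs
        exact (out (T₁.subset w hw (hsw hi)) (hsI hi)).elim
      · exact ⟨w, Forest.mem_vee.mpr (Or.inr (Or.inr hw)), hsw, T₂.subset w hw⟩
  have hFF : F = Forest.disjUnion (F.part I₁ Finset.subset_union_left)
      (F.part I₂ Finset.subset_union_right) hI := by
    ext s
    rw [Forest.disjUnion, Finset.mem_union, Forest.part, Forest.part, Finset.mem_filter,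
      Finset.mem_filter]
    refine ⟨fun hs => ?_, fun hs => hs.elim And.left And.left⟩
    obtain ⟨w, hsw, hw | hw⟩ := hF s hs
    · exact Or.inl ⟨hs, hsw.trans (T₁.subset w hw)⟩
    · exact Or.inr ⟨hs, hsw.trans (T₂.subset w hw)⟩
  refine ⟨_, _, h₁, h₂, h, hFF, ?_⟩
  have key : ∀ {F F' : Forest (I₁ ∪ I₂)} (_ : F = F') (h : F ≤ Forest.vee T₁ T₂ hT₁ hT₂ hI)
      (h' : F' ≤ Forest.vee T₁ T₂ hT₁ hT₂ hI), Forest.intervalM h = Forest.intervalM h' := by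
    rintro F _ rfl _ _
    rfl
  rw [key hFF h (hFF ▸ h)]
  exact Forest.intervalM_vee h₁ h₂ _
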